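/- Let $C_1,\dots,C_m\in\mathbb C^{3\times 4}$ be matrices of rank $3$ whose kernels (the camera centers) $c_i=\ker C_i\in\mathbb P^3$ are pairwise distinct. Let $\mathbb G$ be the Grassmannian of lines in $\mathbb P^3$ over $\mathbb C$, and identify a line of $\mathbb P^2$ with the point $\ell\in\mathbb P^2$ such that $x^T\ell=0$ is its equation. For a line $L\in\mathbb G$ through no center, let $\Upsilon_{\mathcal C}(L)=(C_1\cdot L,\dots,C_m\cdot L)\in(\mathbb P^2)^m$ be the tuple of its image lines, and let $\mathcal L_{\mathcal C}$ be the Zariski closure in $(\mathbb P^2)^m$ of the set of all these tuples. For $\ell=(\ell_1,\dots,\ell_m)\in(\mathbb P^2)^m$ let $H_i=\{p\in\mathbb P^3\mid p^TC_i^T\ell_i=0\}$. For $I\subseteq\{1,\dots,m\}$ let $E_I$ be the linear span of the centers $c_i$, $i\in I$. If $E_I$ is a line, put $E_I^*=\{p\in\mathbb P^3\mid p^*q=0\text{ for all }q\in E_I\}$, where $p^*$ is the conjugate transpose, put $F_I(\ell_i)=\operatorname{span}\big(\{c_i\}\cup(H_i\cap E_I^*)\big)$ for $i\in I$, and let $$\mathcal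 Y_{\mathcal C,I}=\Big\{\ell\in(\mathbb P^2)^m \;\Big|\; \dim\bigcap_{i\in I}\{L\in\mathbb G\mid L\cap F_I(\ell_i)\neq\emptyset\}\ \ge\ 1\Big\}.$$ Here $\dim$ is the dimension of a subvariety of $\mathbb G$, so the condition says that the spaces $F_I(\ell_i)$, $i\in I$, have infinitely many common transversals. Let $\mathcal Y_{\mathcal C}$ be the intersection of the sets $\mathcal Y_{\mathcal C,I}$ over all $I\subseteq\{1,\dots,m\}$ for which $E_I$ is a line. Then $$\mathcal L_{\mathcal C}=\big\{\ell\in(\mathbb P^2)^m \;\big|\; \operatorname{rank}\,[\,C_1^T\ell_1\ \cdots\ C_m^T\ell_m\,]\le 2\big\}\cap\mathcal Y_{\mathcal C}.$$ -/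

import Mathlib

open scoped LinearAlgebra.Projectivization

namespace LineMultiview

/-- The complex projective plane, also used for its dual: a point `ℓ` is identified with the line
of the plane that has equation `xᵀ ℓ = 0`. -/
abbrev Plane : Type := ℙ ℂ (Fin 3 → ℂ)

/-- The Grassmannian of lines in complex projective 3-space, a line being a two-dimensional linear
subspace of `ℂ⁴`.  Linear subspaces of `ℙ³` are throughout represented by the corresponding
submodules of `ℂ⁴`. -/
abbrev Gr : Type := {W : Submodule ℂ (Fin 4 → ℂ) // Module.finrank ℂ W = 2}

/-- The linear subspace `{x | xᵀ v = 0}` of `ℂⁿ`. -/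
def orth {n : ℕ} (v : Fin n → ℂ) : Submodule ℂ (Fin n → ℂ) where
  carrier := {x | x ⬝ᵥ v = 0}
  add_mem' := by
    intro a b ha hb
    simp only [Set.mem_ofPred_eq] at *
    rw [add_dotProduct, ha, hb, add_zero]
  zero_mem' := by simp
  smul_mem' := by
    intro c a ha
    simp only [Set.mem_ofPred_eq] at *
    rw [smul_dotProduct, ha, smul_zero]

/-- The dual `E* = {p | p* q = 0 for all q ∈ E}` of a linear subspace, with respect to the standard
Hermitian inner product. -/
def hermitianDual (E : Submodule ℂ (Fin 4 → ℂ)) : Submodule ℂ (Fin 4 → ℂ) where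
  carrier := {p | ∀ q ∈ E, star p ⬝ᵥ q = 0}
  add_mem' := by
    intro a b ha hb q hq
    rw [star_add, add_dotProduct, ha q hq, hb q hq, add_zero]
  zero_mem' := by
    intro q _
    simp
  smul_mem' := by
    intro c a ha q hq
    rw [star_smul, smul_dotProduct, ha q hq, smul_zero]

/-! ### Varieties -/

section Varieties

variable {m : ℕ}

/-- A polynomial in `m` groups of three variables is multihomogeneous: all its monomials have the
same degree `d i` in the `i`-th group of variables. -/
def IsMultihomogeneous (f : MvPolynomial (Fin m × Fin 3) ℂ) : Prop :=
  ∃ d : Fin m → ℕ, ∀ s ∈ f.support, ∀ i, ∑ j, s (i, j) = d i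

/-- Vanishing of `f` at a point of `(ℙ²)ᵐ`; for multihomogeneous `f` this does not depend on the
representatives. -/
def VanishesAt (f : MvPolynomial (Fin m × Fin 3) ℂ) (ℓ : Fin m → Plane) : Prop :=
  MvPolynomial.eval (fun p : Fin m × Fin 3 => (ℓ p.1).rep p.2) f = 0

/-- Algebraic subvarieties of `(ℙ²)ᵐ`: common zero sets of multihomogeneous polynomials. -/
def IsVariety (X : Set (Fin m → Plane)) : Prop :=
  ∃ S : Set (MvPolynomial (Fin m × Fin 3) ℂ),
    (∀ f ∈ S, IsMultihomogeneous f) ∧ X = {ℓ | ∀ f ∈ S, VanishesAt f ℓ}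

/-- The Zariski closure of a subset of `(ℙ²)ᵐ`: the smallest algebraic variety containing it. -/
def zariskiClosure (U : Set (Fin m → Plane)) : Set (Fin m → Plane) :=
  ⋂₀ {X | IsVariety X ∧ U ⊆ X}

/-- The skew-symmetric matrix `x yᵀ - y xᵀ`, whose entries are the Plücker coordinates of the line
spanned by `x` and `y`. -/
def wedge (x y : Fin 4 → ℂ) : Fin 4 × Fin 4 → ℂ :=
  fun p => x p.1 * y p.2 - y p.1 * x p.2

/-- Vanishing of `f` at the Plücker coordinates of the line `L`; for homogeneous `f` this does not
depend on the spanning points. -/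
def VanishesAtLine (f : MvPolynomial (Fin 4 × Fin 4) ℂ) (L : Gr) : Prop :=
  ∀ x y : Fin 4 → ℂ, L.1 = Submodule.span ℂ {x, y} → MvPolynomial.eval (wedge x y) f = 0

/-- Algebraic subvarieties of the Grassmannian in its Plücker embedding. -/
def IsGrVariety (X : Set Gr) : Prop :=
  ∃ S : Set (MvPolynomial (Fin 4 × Fin 4) ℂ),
    (∀ f ∈ S, ∃ d : ℕ, f.IsHomogeneous d) ∧ X = {L | ∀ f ∈ S, VanishesAtLine f L}

/-- Nonempty irreducible subvarieties of the Grassmannian. -/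
def IsIrreducibleGrVariety (X : Set Gr) : Prop :=
  IsGrVariety X ∧ X.Nonempty ∧
    ∀ A B : Set Gr, IsGrVariety A → IsGrVariety B → X = A ∪ B → X = A ∨ X = B

/-- The dimension of a subvariety `Z` of the Grassmannian: the supremum of the lengths of the chains
`X₀ ⊊ X₁ ⊊ ⋯ ⊊ X_d ⊆ Z` of nonempty irreducible subvarieties (`⊥` if `Z` is empty). -/
noncomputable def grDim (Z : Set Gr) : WithBot ℕ∞ :=
  Order.krullDim {X : Set Gr // IsIrreducibleGrVariety X ∧ X ⊆ Z}

end Varieties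

/-! ### Cameras -/

/-- The center of a camera: the kernel of its matrix. -/
def center (C : Matrix (Fin 3) (Fin 4) ℂ) : Submodule ℂ (Fin 4 → ℂ) :=
  LinearMap.ker C.mulVecLin

/-- The graph of the camera map on lines: `L` does not pass through the center of `C`, and `C · L`
is the line of the image plane with equation `ℓ`. -/
def IsImageLine (C : Matrix (Fin 3) (Fin 4) ℂ) (L : Gr) (ℓ : Plane) : Prop :=
  center C ⊓ L.1 = ⊥ ∧ L.1.map C.mulVecLin = orth ℓ.rep

/-- The plane `{p | pᵀ Cᵀ ℓ = 0}` of 3-space that `C` projects to the image line `ℓ`. -/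
noncomputable def backProjectedPlane (C : Matrix (Fin 3) (Fin 4) ℂ) (ℓ : Plane) : Submodule ℂ (Fin 4 → ℂ) :=
  orth (C.transpose.mulVec ℓ.rep)

section Arrangement

variable {m : ℕ} (C : Fin m → Matrix (Fin 3) (Fin 4) ℂ)

/-- The image of the joint camera map `L ↦ (C₁ · L, …, C_m · L)`, which is defined on the lines that
pass through no camera center. -/
def jointImage : Set (Fin m → Plane) :=
  {ℓ | ∃ L : Gr, ∀ i, IsImageLine (C i) L (ℓ i)}

/-- The line multiview variety. -/
def lineMultiviewVariety : Set (Fin m → Plane) :=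
  zariskiClosure (jointImage C)

/-- The `4 × m` matrix with columns `C_iᵀ ℓ_i`. -/
noncomputable def imageMatrix (ℓ : Fin m → Plane) : Matrix (Fin 4) (Fin m) ℂ :=
  Matrix.of fun a i => (C i).transpose.mulVec (ℓ i).rep a

/-- The span `E_I` of the centers with index in `I`. -/
def centerSpan (I : Finset (Fin m)) : Submodule ℂ (Fin 4 → ℂ) :=
  ⨆ i ∈ I, center (C i)

/-- The space `F_I(ℓ_i)` spanned by the center `c_i` and the intersection of the back-projected
plane of `ℓ_i` with the dual line of `E_I`. -/
noncomputable def transversalSpace (I : Finset (Fin m)) (ℓ : Fin m → Plane) (i : Fin m) :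
    Submodule ℂ (Fin 4 → ℂ) :=
  center (C i) ⊔ (backProjectedPlane (C i) (ℓ i) ⊓ hermitianDual (centerSpan C I))

/-- The Schubert variety of lines that meet the linear subspace `F`. -/
def schubert (F : Submodule ℂ (Fin 4 → ℂ)) : Set Gr :=
  {L | L.1 ⊓ F ≠ ⊥}

/-- The exceptional locus of `I`: the lines that meet all `F_I(ℓ_i)`, `i ∈ I`, form a positive
dimensional variety. -/
def exceptionalLocusAt (I : Finset (Fin m)) : Set (Fin m → Plane) :=
  {ℓ | 1 ≤ grDim (⋂ i ∈ I, schubert (transversalSpace C I ℓ i))}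

/-- The exceptional locus: the intersection of the exceptional loci of all sets `I` of indices whose
centers span a line. -/
def exceptionalLocus : Set (Fin m → Plane) :=
  ⋂ (I : Finset (Fin m)) (_ : Module.finrank ℂ (centerSpan C I) = 2), exceptionalLocusAt C I

end Arrangement

end LineMultiview

namespace LineMultiview

/-! ### Subvarieties of the Grassmannian -/

/-! The key is to replace the Schubert condition by linear algebra. A line that is the graph of a
linear map from `E_I` to its Hermitian dual meets `F_I(ℓ_i)` exactly when that map sends `c_i` into
`H_i`. By Noetherianity positive dimension means infinitely many transversals, so the condition says
that some nonzero map `φ : E_I → E_I*` has `φ c_i ∈ H_i` for all `i ∈ I`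
(`mem_exceptionalLocusAt_iff`).

For `⊆` it suffices that both conditions are closed and hold for image tuples. Each becomes the
solvability of linear systems whose rows are multihomogeneous in `ℓ`, that is, the vanishing of
minors (`isVariety_linearSystem`). A line with image `ℓ` lies in every `H_i`, and it induces a
compatible map (`hasCompatibleMap_of_mem_jointImage`).

For `⊇` the rank condition gives a line `L` in all the planes `H_i`. Deform `L` by `id + tM + t²N`.
Where `L` misses a center, the image line is continuous at `t = 0`. Where `L` contains `c_i`, the
limiting image line is governed by the first nonzero displacement of `c_i`, which must lie in `H_i`
and off `L` (`exists_perturbed_normal`). If `L` contains at most one center, such a displacement is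
easy to find. Otherwise `L = E_I` for the set `I` of centers on `L`, and `M = φ` works, except that
`φ` may kill one center; that center is displaced at second order by `N`. -/

theorem exists_basis_of_line (L : Gr) :
    ∃ x y : Fin 4 → ℂ, LinearIndependent ℂ ![x, y] ∧ L.1 = Submodule.span ℂ {x, y} := by
  have b := Module.finBasisOfFinrankEq ℂ L.1 L.2
  refine ⟨b 0, b 1, ?_, ?_⟩
  · have h := b.linearIndependent.map' L.1.subtype (Submodule.ker_subtype _)
    have e : L.1.subtype ∘ b = ![(b 0 : Fin 4 → ℂ), b 1] := by
      ext i : 1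
      fin_cases i <;> rfl
    rwa [e] at h
  · have h : Submodule.span ℂ (Set.range (L.1.subtype ∘ b)) = L.1 := by
      rw [Set.range_comp, Submodule.span_image, b.span_eq, Submodule.map_top,
        Submodule.range_subtype]
    refine h.symm.trans (congrArg _ ?_)
    ext v
    simp [Fin.exists_fin_two, eq_comm]

theorem linearIndependent_of_span_eq {L : Gr} {x y : Fin 4 → ℂ}
    (h : L.1 = Submodule.span ℂ {x, y}) : LinearIndependent ℂ ![x, y] := by
  rw [linearIndependent_iff_card_eq_finrank_span, Matrix.range_cons, Matrix.range_cons,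
    Matrix.range_empty, Set.union_empty, Set.singleton_union, Set.finrank, ← h, L.2]
  rfl

theorem finrank_span_pair_of_linearIndependent {x y : Fin 4 → ℂ}
    (h : LinearIndependent ℂ ![x, y]) : Module.finrank ℂ (Submodule.span ℂ {x, y}) = 2 := by
  have := finrank_span_eq_card h
  rwa [Matrix.range_cons, Matrix.range_cons, Matrix.range_empty, Set.union_empty,
    Set.singleton_union, Fintype.card_fin] at this

theorem isGrVariety_empty : IsGrVariety ∅ := by
  refine ⟨{1}, ?_, ?_⟩
  · rintro f rfl
    exact ⟨0, MvPolynomial.isHomogeneous_one _ _⟩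
  · ext L
    obtain ⟨x, y, -, h⟩ := exists_basis_of_line L
    simp only [Set.mem_empty_iff_false, Set.mem_singleton_iff, forall_eq, Set.mem_ofPred_eq,
      false_iff]
    exact fun H => by simpa using H x y h

theorem IsGrVariety.iInter {ι : Sort*} {X : ι → Set Gr} (h : ∀ i, IsGrVariety (X i)) :
    IsGrVariety (⋂ i, X i) := by
  choose S hS hX using h
  refine ⟨⋃ i, S i, ?_, ?_⟩
  · intro f hf
    obtain ⟨i, hi⟩ := Set.mem_iUnion.1 hf
    exact hS i f hi
  · ext L
    simp only [Set.mem_iInter, Set.mem_iUnion, forall_exists_index, Set.mem_ofPred_eq]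
    constructor
    · intro H f i hf
      have := H i
      rw [hX i] at this
      exact this f hf
    · intro H i
      rw [hX i]
      exact fun f hf => H f i hf

/-- The ideal of all polynomials that vanish on a set of lines. -/
def vanishingIdeal (X : Set Gr) : Ideal (MvPolynomial (Fin 4 × Fin 4) ℂ) where
  carrier := {f | ∀ L ∈ X, VanishesAtLine f L}
  add_mem' := by
    intro f g hf hg L hL x y h
    rw [map_add, hf L hL x y h, hg L hL x y h, add_zero]
  zero_mem' := by
    intro L _ x y _
    simp
  smul_mem' := by
    intro c f hf L hL x y h
    rw [smul_eq_mul, map_mul, hf L hL x y h, mul_zero]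

theorem mem_vanishingIdeal {X : Set Gr} {f : MvPolynomial (Fin 4 × Fin 4) ℂ} :
    f ∈ vanishingIdeal X ↔ ∀ L ∈ X, VanishesAtLine f L := Iff.rfl

/-- A variety is recovered from its ideal, so the inclusion of ideals remains strict. -/
theorem vanishingIdeal_lt {X Y : Set Gr} (hX : IsGrVariety X) (h : X ⊂ Y) :
    vanishingIdeal Y < vanishingIdeal X := by
  refine lt_of_le_not_ge (fun f hf L hL => hf L (h.1 hL)) fun hle => h.2 ?_
  obtain ⟨S, -, hS⟩ := hX
  intro L hL
  rw [hS]
  intro f hf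
  refine mem_vanishingIdeal.1 (hle ?_) L hL
  intro L' hL'
  rw [hS] at hL'
  exact hL' f hf

/-- A change of basis multiplies the Plücker vector by its determinant, hence the value of `f` by
the `d`-th power of it. -/
theorem VanishesAtLine.of_basis {f : MvPolynomial (Fin 4 × Fin 4) ℂ} {d : ℕ}
    (hf : f.IsHomogeneous d) {L : Gr} {x y : Fin 4 → ℂ} (h : L.1 = Submodule.span ℂ {x, y})
    (h0 : MvPolynomial.eval (wedge x y) f = 0) : VanishesAtLine f L := by
  intro x' y' h'
  have hx' : x' ∈ Submodule.span ℂ {x, y} := by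
    rw [← h, h']; exact Submodule.subset_span (by simp)
  have hy' : y' ∈ Submodule.span ℂ {x, y} := by
    rw [← h, h']; exact Submodule.subset_span (by simp)
  obtain ⟨a, b, rfl⟩ := Submodule.mem_span_pair.1 hx'
  obtain ⟨c, e, rfl⟩ := Submodule.mem_span_pair.1 hy'
  have : wedge (a • x + b • y) (c • x + e • y) = fun p => (a * e - b * c) * wedge x y p := by
    ext p
    simp only [wedge, Pi.add_apply, Pi.smul_apply, smul_eq_mul]
    ring
  rw [this, MvPolynomial.eval_eq']
  rw [MvPolynomial.eval_eq'] at h0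
  have key : ∀ s ∈ f.support, f.coeff s * ∏ i, ((a * e - b * c) * wedge x y i) ^ s i =
      (a * e - b * c) ^ d * (f.coeff s * ∏ i, wedge x y i ^ s i) := by
    intro s hs
    have hd : ∑ i, s i = d := by
      have := hf (MvPolynomial.mem_support_iff.1 hs)
      rw [Finsupp.weight_apply, Finsupp.sum_fintype _ _ (by simp)] at this
      simpa using this
    simp_rw [mul_pow]
    rw [Finset.prod_mul_distrib, Finset.prod_pow_eq_pow_sum, hd]
    ring
  rw [Finset.sum_congr rfl key, ← Finset.mul_sum, h0, mul_zero]

theorem IsGrVariety.union {X Y : Set Gr} (hX : IsGrVariety X) (hY : IsGrVariety Y) :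
    IsGrVariety (X ∪ Y) := by
  obtain ⟨S, hS, rfl⟩ := hX
  obtain ⟨T, hT, rfl⟩ := hY
  refine ⟨{p | ∃ f ∈ S, ∃ g ∈ T, p = f * g}, ?_, ?_⟩
  · rintro p ⟨f, hf, g, hg, rfl⟩
    obtain ⟨a, ha⟩ := hS f hf
    obtain ⟨b, hb⟩ := hT g hg
    exact ⟨a + b, ha.mul hb⟩
  · ext L
    constructor
    · rintro (h | h) p ⟨f, hf, g, hg, rfl⟩ x y hL
      · rw [map_mul, h f hf x y hL, zero_mul]
      · rw [map_mul, h g hg x y hL, mul_zero]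
    · intro H
      by_contra hcon
      simp only [Set.mem_union, Set.mem_ofPred_eq, not_or, not_forall] at hcon
      obtain ⟨⟨f, hf, hfL⟩, ⟨g, hg, hgL⟩⟩ := hcon
      obtain ⟨a, ha⟩ := hS f hf
      obtain ⟨b, hb⟩ := hT g hg
      obtain ⟨x, y, -, h⟩ := exists_basis_of_line L
      have := H (f * g) ⟨f, hf, g, hg, rfl⟩ x y h
      rw [map_mul, mul_eq_zero] at this
      exact this.elim (fun h0 => hfL (.of_basis ha h h0)) (fun h0 => hgL (.of_basis hb h h0))

/-! ### Linear conditions on Plücker coordinates -/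

/-- The linear form in the Plücker coordinates that corresponds to the decomposable alternating form
`h ∧ k`. -/
noncomputable def wedgeForm (h k : Module.Dual ℂ (Fin 4 → ℂ)) :
    MvPolynomial (Fin 4 × Fin 4) ℂ :=
  ∑ a, ∑ b, MvPolynomial.C (h (Pi.single a 1) * k (Pi.single b 1)) * MvPolynomial.X (a, b)

theorem dual_eq_sum (h : Module.Dual ℂ (Fin 4 → ℂ)) (x : Fin 4 → ℂ) :
    h x = ∑ a, h (Pi.single a 1) * x a := by
  conv_lhs => rw [pi_eq_sum_univ' x]
  simp [mul_comm]

theorem eval_wedgeForm (h k : Module.Dual ℂ (Fin 4 → ℂ)) (x y : Fin 4 → ℂ) :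
    MvPolynomial.eval (wedge x y) (wedgeForm h k) = h x * k y - h y * k x := by
  rw [dual_eq_sum h x, dual_eq_sum h y, dual_eq_sum k x, dual_eq_sum k y, Finset.sum_mul_sum,
    Finset.sum_mul_sum, ← Finset.sum_sub_distrib]
  simp only [wedgeForm, map_sum, map_mul, MvPolynomial.eval_C, MvPolynomial.eval_X, wedge,
    ← Finset.sum_sub_distrib]
  exact Finset.sum_congr rfl fun a _ => Finset.sum_congr rfl fun b _ => by ring

theorem isHomogeneous_wedgeForm (h k : Module.Dual ℂ (Fin 4 → ℂ)) :
    (wedgeForm h k).IsHomogeneous 1 :=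
  MvPolynomial.IsHomogeneous.sum _ _ _ fun _ _ => MvPolynomial.IsHomogeneous.sum _ _ _ fun _ _ =>
    (MvPolynomial.isHomogeneous_X _ _).C_mul _

theorem isGrVariety_wedgeForms (S : Set (Module.Dual ℂ (Fin 4 → ℂ) × Module.Dual ℂ (Fin 4 → ℂ))) :
    IsGrVariety {L | ∀ p ∈ S, VanishesAtLine (wedgeForm p.1 p.2) L} := by
  refine ⟨(fun p => wedgeForm p.1 p.2) '' S, ?_, ?_⟩
  · rintro _ ⟨p, -, rfl⟩
    exact ⟨1, isHomogeneous_wedgeForm _ _⟩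
  · ext L
    simp only [Set.forall_mem_image, Set.mem_ofPred_eq]

theorem vanishesAtLine_wedgeForm {h k : Module.Dual ℂ (Fin 4 → ℂ)} {L : Gr} {x y : Fin 4 → ℂ}
    (hL : L.1 = Submodule.span ℂ {x, y}) :
    VanishesAtLine (wedgeForm h k) L ↔ h x * k y - h y * k x = 0 := by
  rw [← eval_wedgeForm]
  exact ⟨fun H => H x y hL, fun H => .of_basis (isHomogeneous_wedgeForm _ _) hL H⟩

theorem isGrVariety_singleton (L : Gr) : IsGrVariety {L} := by
  convert isGrVariety_wedgeForms {p | p.1 ∈ L.1.dualAnnihilator} using 1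
  ext L'
  obtain ⟨x, y, hli, h⟩ := exists_basis_of_line L'
  simp only [Set.mem_singleton_iff, Set.mem_ofPred_eq, vanishesAtLine_wedgeForm h]
  constructor
  · rintro rfl ⟨f, k⟩ hf
    have hx : f x = 0 := (Submodule.mem_dualAnnihilator f).1 hf x (by
      rw [h]; exact Submodule.subset_span (by simp))
    have hy : f y = 0 := (Submodule.mem_dualAnnihilator f).1 hf y (by
      rw [h]; exact Submodule.subset_span (by simp))
    simp [hx, hy]
  · intro H
    have key : ∀ f ∈ L.1.dualAnnihilator, f x = 0 ∧ f y = 0 := by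
      intro f hf
      -- With `f` fixed and `k` arbitrary, the vanishing of `f ∧ k` on the line says that every
      -- functional kills this vector.
      have h2 : f x • y - f y • x = 0 := by
        rw [← Module.forall_dual_apply_eq_zero_iff ℂ]
        intro k
        simpa using H (f, k) hf
      have := LinearIndependent.pair_iff.1 hli (-(f y)) (f x) (by rw [← h2]; module)
      exact ⟨this.2, neg_eq_zero.1 this.1⟩
    have hle : L'.1 ≤ L.1 := by
      rw [h, Submodule.span_le]
      rintro v hv
      have : v ∈ L.1.dualAnnihilator.dualCoannihilator := by
        rw [Submodule.mem_dualCoannihilator]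
        intro f hf
        rcases hv with rfl | rfl
        · exact (key f hf).1
        · exact (key f hf).2
      rwa [Subspace.dualAnnihilator_dualCoannihilator_eq] at this
    exact Subtype.ext (Submodule.eq_of_le_of_finrank_eq hle (L'.2.trans L.2.symm))

theorem isGrVariety_of_finite {X : Set Gr} (h : X.Finite) : IsGrVariety X := by
  induction X, h using Set.Finite.induction_on with
  | empty => exact isGrVariety_empty
  | insert _ _ ih => exact (isGrVariety_singleton _).union ih

theorem isIrreducibleGrVariety_singleton (L : Gr) : IsIrreducibleGrVariety {L} := by
  refine ⟨isGrVariety_singleton L, Set.singleton_nonempty L, fun A B _ _ h => ?_⟩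
  have hA : A ⊆ {L} := h ▸ Set.subset_union_left
  have hB : B ⊆ {L} := h ▸ Set.subset_union_right
  rcases Set.subset_singleton_iff_eq.1 hA with rfl | rfl
  · right
    simpa using h
  · exact Or.inl rfl

/-! ### Positive dimension is the same as being infinite -/

/-- In a finite set every subset is closed, so a single point splits off and contradicts
irreducibility. -/
theorem IsIrreducibleGrVariety.infinite {X Y : Set Gr} (hX : IsIrreducibleGrVariety X)
    (hY : IsIrreducibleGrVariety Y) (h : X ⊂ Y) : Y.Infinite := by
  intro hfin
  obtain ⟨L, hL⟩ := hX.2.1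
  have hLY : {L} ⊆ Y := Set.singleton_subset_iff.2 (h.1 hL)
  rcases hY.2.2 {L} (Y \ {L}) (isGrVariety_singleton L) (isGrVariety_of_finite hfin.sdiff)
    (Set.union_sdiff_cancel hLY).symm with h1 | h1
  · exact h.2 (by rw [h1]; exact Set.singleton_subset_iff.2 hL)
  · have : L ∈ Y \ {L} := h1 ▸ h.1 hL
    exact this.2 rfl

theorem exists_infinite_irreducible {Z : Set Gr} (hZ : IsGrVariety Z) (hinf : Z.Infinite) :
    ∃ X ⊆ Z, IsIrreducibleGrVariety X ∧ X.Infinite := by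
  -- A maximal ideal among those of infinite subvarieties gives a minimal infinite subvariety. It is
  -- irreducible, since one of two sets covering it is again infinite.
  obtain ⟨J, ⟨X, ⟨hXZ, hXv, hXi⟩, rfl⟩, hmax⟩ := set_has_maximal_iff_noetherian.2
    (inferInstance : IsNoetherianRing (MvPolynomial (Fin 4 × Fin 4) ℂ))
    (vanishingIdeal '' {X | X ⊆ Z ∧ IsGrVariety X ∧ X.Infinite}) ⟨_, Z, ⟨subset_rfl, hZ, hinf⟩, rfl⟩
  have hmin : ∀ A ⊆ X, IsGrVariety A → A.Infinite → X = A := by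
    intro A hA hAv hAi
    by_contra hne
    exact hmax _ ⟨A, ⟨hA.trans hXZ, hAv, hAi⟩, rfl⟩
      (vanishingIdeal_lt hAv (hA.ssubset_of_ne (Ne.symm hne)))
  refine ⟨X, hXZ, ⟨hXv, hXi.nonempty, fun A B hA hB h => ?_⟩, hXi⟩
  have := hXi
  rw [h, Set.infinite_union] at this
  exact this.imp (hmin A (h ▸ Set.subset_union_left) hA) (hmin B (h ▸ Set.subset_union_right) hB)

theorem one_le_grDim_iff {Z : Set Gr} (hZ : IsGrVariety Z) : 1 ≤ grDim Z ↔ Z.Infinite := by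
  rw [grDim, Order.one_le_krullDim_iff]
  constructor
  · rintro ⟨X, Y, h⟩
    exact (X.2.1.infinite Y.2.1 h).mono Y.2.2
  · intro h
    obtain ⟨X, hXZ, hX, hXi⟩ := exists_infinite_irreducible hZ h
    obtain ⟨L, hL⟩ := hXi.nonempty
    have hLX : {L} ⊆ X := Set.singleton_subset_iff.2 hL
    refine ⟨⟨{L}, isIrreducibleGrVariety_singleton L, hLX.trans hXZ⟩, ⟨X, hX, hXZ⟩, ?_⟩
    refine lt_of_le_of_ne hLX fun he => hXi ?_
    rw [← Subtype.mk.inj he]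
    exact Set.finite_singleton L

/-! ### Subvarieties of a product of planes -/

section Multiprojective

variable {m : ℕ}

/-- The multidegrees of the variables. -/
def multiweight (p : Fin m × Fin 3) : Fin m → ℕ := Pi.single p.1 1

theorem weight_multiweight (s : Fin m × Fin 3 →₀ ℕ) (i : Fin m) :
    Finsupp.weight multiweight s i = ∑ j, s (i, j) := by
  rw [Finsupp.weight_apply, Finsupp.sum_fintype _ _ (by simp), Finset.sum_apply,
    Fintype.sum_prod_type, Finset.sum_eq_single i]
  · simp [multiweight]
  · intro k _ hk
    simp [multiweight, hk.symm]
  · simp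

theorem isMultihomogeneous_of_isWeightedHomogeneous {f : MvPolynomial (Fin m × Fin 3) ℂ}
    {d : Fin m → ℕ} (hf : MvPolynomial.IsWeightedHomogeneous multiweight f d) :
    IsMultihomogeneous f := by
  refine ⟨d, fun s hs i => ?_⟩
  rw [← weight_multiweight, hf (MvPolynomial.mem_support_iff.1 hs)]

theorem IsMultihomogeneous.eval_eq_zero_iff {f : MvPolynomial (Fin m × Fin 3) ℂ}
    (hf : IsMultihomogeneous f) {ℓ : Fin m → Plane} {y : Fin m → Fin 3 → ℂ}
    (h : ∀ i, ∃ c : ℂ, (ℓ i).rep = c • y i) :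
    VanishesAt f ℓ ↔ MvPolynomial.eval (fun p : Fin m × Fin 3 => y p.1 p.2) f = 0 := by
  obtain ⟨d, hd⟩ := hf
  choose c hc using h
  have hc0 : ∀ i, c i ≠ 0 := fun i h0 => (ℓ i).rep_nonzero (by rw [hc i, h0, zero_smul])
  have key : ∀ s ∈ f.support,
      f.coeff s * ∏ p : Fin m × Fin 3, (c p.1 * y p.1 p.2) ^ s p =
      (∏ i, c i ^ d i) * (f.coeff s * ∏ p : Fin m × Fin 3, y p.1 p.2 ^ s p) := by
    intro s hs
    simp_rw [mul_pow]
    rw [Finset.prod_mul_distrib]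
    have : ∏ p : Fin m × Fin 3, c p.1 ^ s p = ∏ i, c i ^ d i := by
      rw [Fintype.prod_prod_type]
      refine Finset.prod_congr rfl fun i _ => ?_
      simp only
      rw [Finset.prod_pow_eq_pow_sum, hd s hs i]
    rw [this]
    ring
  have e : MvPolynomial.eval (fun p : Fin m × Fin 3 => (ℓ p.1).rep p.2) f =
      (∏ i, c i ^ d i) * MvPolynomial.eval (fun p : Fin m × Fin 3 => y p.1 p.2) f := by
    simp_rw [hc, Pi.smul_apply, smul_eq_mul]
    rw [MvPolynomial.eval_eq', MvPolynomial.eval_eq', Finset.sum_congr rfl key, Finset.mul_sum]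
  rw [VanishesAt, e, mul_eq_zero, or_iff_right]
  exact Finset.prod_ne_zero_iff.2 fun i _ => pow_ne_zero _ (hc0 i)

open Filter Topology in
-- Zariski closed sets are closed in the Euclidean topology; working with curves of representatives
-- avoids a topology on the projective planes.
theorem mem_zariskiClosure_of_limit {U : Set (Fin m → Plane)} {ℓ : Fin m → Plane}
    (P : Fin m → ℂ → Fin 3 → ℂ) (hP : ∀ i, Continuous (P i))
    (h0 : ∀ i, ∃ c : ℂ, (ℓ i).rep = c • P i 0)
    (h : ∀ᶠ t in 𝓝[≠] (0 : ℂ), ∃ ℓ' ∈ U, ∀ i, ∃ c : ℂ, (ℓ' i).rep = c • P i t) :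
    ℓ ∈ zariskiClosure U := by
  rintro X ⟨⟨S, hS, rfl⟩, hU⟩ f hf
  rw [(hS f hf).eval_eq_zero_iff h0]
  have hcont : Continuous fun t =>
      MvPolynomial.eval (fun p : Fin m × Fin 3 => P p.1 t p.2) f :=
    (MvPolynomial.continuous_eval f).comp
      (continuous_pi fun p => (continuous_apply p.2).comp (hP p.1))
  have h1 := (hcont.tendsto 0).mono_left (nhdsWithin_le_nhds (s := {0}ᶜ))
  refine tendsto_nhds_unique h1 (tendsto_const_nhds.congr' ?_)
  filter_upwards [h] with t ⟨ℓ', hℓ', hc⟩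
  exact (((hS f hf).eval_eq_zero_iff hc).1 (hU hℓ' f hf)).symm

theorem zariskiClosure_subset {U X : Set (Fin m → Plane)} (hX : IsVariety X) (h : U ⊆ X) :
    zariskiClosure U ⊆ X :=
  Set.sInter_subset_of_mem ⟨hX, h⟩

/-! ### Solvability of linear systems as a closed condition -/

theorem exists_dotProduct_eq_zero_iff {K ι κ : Type*} [Field K] [Fintype κ] [DecidableEq κ]
    (R : ι → κ → K) :
    (∃ x ≠ 0, ∀ a, R a ⬝ᵥ x = 0) ↔ ∀ r : κ → ι, (Matrix.of fun k => R (r k)).det = 0 := by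
  constructor
  · rintro ⟨x, hx, h⟩ r
    exact Matrix.exists_mulVec_eq_zero_iff.1 ⟨x, hx, funext fun k => h (r k)⟩
  · intro h
    by_contra hcon
    -- A functional vanishing on a proper span would be a nonzero solution. Once the rows span, a
    -- basis chosen among them has nonzero determinant.
    have hspan : Submodule.span K (Set.range R) = ⊤ := by
      by_contra hne
      obtain ⟨f, hf, hfe⟩ := Submodule.exists_dual_map_eq_bot_of_lt_top
        (lt_top_iff_ne_top.2 hne) inferInstance
      have hfd : ∀ v, f v = v ⬝ᵥ fun k => f (Pi.single k 1) := by
        intro v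
        conv_lhs => rw [pi_eq_sum_univ' v]
        simp [dotProduct]
      refine hcon ⟨fun k => f (Pi.single k 1), fun h0 => hf ?_, fun a => ?_⟩
      · refine LinearMap.ext fun v => ?_
        rw [hfd, h0, dotProduct_zero, LinearMap.zero_apply]
      · rw [← hfd, ← Submodule.mem_bot K, ← hfe]
        exact Submodule.mem_map_of_mem (Submodule.subset_span ⟨a, rfl⟩)
    obtain ⟨f, hf, -, hli⟩ := Submodule.exists_fun_fin_finrank_span_eq K (Set.range R)
    have e : κ ≃ Fin (Module.finrank K (Submodule.span K (Set.range R))) :=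
      Fintype.equivOfCardEq (by rw [hspan, finrank_top, Fintype.card_fin,
        Module.finrank_fintype_fun_eq_card])
    choose r hr using hf
    have := Matrix.linearIndependent_rows_iff_isUnit (A := Matrix.of fun k => R (r (e k))).1 (by
      have he : (Matrix.of fun k => R (r (e k))).row = f ∘ e := funext fun k => hr (e k)
      rw [he]
      exact hli.comp e e.injective)
    rw [Matrix.isUnit_iff_isUnit_det, h] at this
    exact not_isUnit_zero this

/-- The multidegree depends only on the row, so every term of a maximal minor has the same
multidegree. -/
theorem isVariety_linearSystem {ι κ : Type*} [Fintype κ] [DecidableEq κ]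
    (R : ι → κ → MvPolynomial (Fin m × Fin 3) ℂ) (δ : ι → Fin m → ℕ)
    (hR : ∀ a k, MvPolynomial.IsWeightedHomogeneous multiweight (R a k) (δ a)) :
    IsVariety {ℓ | ∃ x ≠ 0, ∀ a, (fun k => MvPolynomial.eval
      (fun p : Fin m × Fin 3 => (ℓ p.1).rep p.2) (R a k)) ⬝ᵥ x = 0} := by
  refine ⟨Set.range fun r : κ → ι => (Matrix.of fun k => R (r k)).det, ?_, ?_⟩
  · rintro _ ⟨r, rfl⟩
    refine isMultihomogeneous_of_isWeightedHomogeneous (d := ∑ k, δ (r k)) ?_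
    simp only
    -- After transposing, the factor with index `i` comes from row `i`, so the row degrees add up
    -- without reindexing by `σ`.
    rw [← Matrix.det_transpose, Matrix.det_apply]
    refine MvPolynomial.IsWeightedHomogeneous.sum _ _ _ fun σ _ => ?_
    have hprod : MvPolynomial.IsWeightedHomogeneous multiweight
        (∏ i, (Matrix.of fun k => R (r k)).transpose (σ i) i) (∑ k, δ (r k)) :=
      MvPolynomial.IsWeightedHomogeneous.prod _ _ _ fun i _ => hR _ _
    rcases Int.units_eq_one_or (Equiv.Perm.sign σ) with h | h
    · rwa [h, one_smul]
    · rw [h, Units.neg_smul, one_smul]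
      exact hprod.neg
  · ext ℓ
    simp only [Set.mem_ofPred_eq, Set.forall_mem_range, VanishesAt]
    rw [exists_dotProduct_eq_zero_iff]
    refine forall_congr' fun r => ?_
    rw [RingHom.map_det]
    rfl

/-- The linear form in the `i`-th group of variables with coefficients `u`. -/
noncomputable def groupForm (i : Fin m) (u : Fin 3 → ℂ) : MvPolynomial (Fin m × Fin 3) ℂ :=
  ∑ j, MvPolynomial.C (u j) * MvPolynomial.X (i, j)

theorem isWeightedHomogeneous_groupForm (i : Fin m) (u : Fin 3 → ℂ) :
    MvPolynomial.IsWeightedHomogeneous multiweight (groupForm i u) (Pi.single i 1) :=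
  MvPolynomial.IsWeightedHomogeneous.sum _ _ _ fun j _ =>
    (MvPolynomial.isWeightedHomogeneous_X ℂ multiweight (i, j)).C_mul _

theorem eval_groupForm (i : Fin m) (u : Fin 3 → ℂ) (ℓ : Fin m → Plane) :
    MvPolynomial.eval (fun p : Fin m × Fin 3 => (ℓ p.1).rep p.2) (groupForm i u) =
      u ⬝ᵥ (ℓ i).rep := by
  simp [groupForm, dotProduct]

end Multiprojective

/-! ### Image lines and perturbations of lines -/

theorem mem_orth {n : ℕ} {v x : Fin n → ℂ} : x ∈ orth v ↔ x ⬝ᵥ v = 0 := Iff.rfl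

theorem mem_backProjectedPlane {C : Matrix (Fin 3) (Fin 4) ℂ} {ℓ : Plane} {p : Fin 4 → ℂ} :
    p ∈ backProjectedPlane C ℓ ↔ C.mulVec p ⬝ᵥ ℓ.rep = 0 := by
  rw [backProjectedPlane, mem_orth, Matrix.mulVec_transpose, dotProduct_comm,
    ← Matrix.dotProduct_mulVec, dotProduct_comm]

theorem mem_center {C : Matrix (Fin 3) (Fin 4) ℂ} {p : Fin 4 → ℂ} :
    p ∈ center C ↔ C.mulVec p = 0 := Iff.rfl

theorem center_le_backProjectedPlane (C : Matrix (Fin 3) (Fin 4) ℂ) (ℓ : Plane) :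
    center C ≤ backProjectedPlane C ℓ := by
  intro p hp
  rw [mem_backProjectedPlane, mem_center.1 hp, zero_dotProduct]

theorem finrank_center {C : Matrix (Fin 3) (Fin 4) ℂ} (hC : C.rank = 3) :
    Module.finrank ℂ (center C) = 1 := by
  have := LinearMap.finrank_range_add_finrank_ker C.mulVecLin
  rw [Module.finrank_fintype_fun_eq_card, Fintype.card_fin] at this
  rw [Matrix.rank] at hC
  rw [center]
  omega

theorem exists_center_eq_span {C : Matrix (Fin 3) (Fin 4) ℂ} (hC : C.rank = 3) :
    ∃ c ≠ 0, center C = Submodule.span ℂ {c} := by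
  obtain ⟨⟨c, hc⟩, h0, h⟩ := finrank_eq_one_iff'.1 (finrank_center hC)
  refine ⟨c, fun h1 => h0 (Subtype.ext h1), le_antisymm (fun p hp => ?_) ?_⟩
  · obtain ⟨a, ha⟩ := h ⟨p, hp⟩
    exact Submodule.mem_span_singleton.2 ⟨a, congrArg Subtype.val ha⟩
  · rwa [Submodule.span_singleton_le_iff_mem]

theorem center_eq_span {C : Matrix (Fin 3) (Fin 4) ℂ} (hC : C.rank = 3) {c : Fin 4 → ℂ}
    (hc : c ∈ center C) (hc0 : c ≠ 0) : center C = Submodule.span ℂ {c} := by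
  obtain ⟨d, hd0, hd⟩ := exists_center_eq_span hC
  obtain ⟨a, rfl⟩ := Submodule.mem_span_singleton.1 (hd ▸ hc)
  rw [hd, Submodule.span_singleton_smul_eq (IsUnit.mk0 a (by rintro rfl; simp at hc0))]

open scoped ComplexOrder in
theorem eq_zero_of_star_dotProduct_self {n : ℕ} {v : Fin n → ℂ} (h : star v ⬝ᵥ v = 0) : v = 0 :=
  dotProduct_star_self_eq_zero.1 h

theorem finrank_orth_lt {n : ℕ} {v : Fin n → ℂ} (hv : v ≠ 0) : Module.finrank ℂ (orth v) < n := by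
  have : orth v < ⊤ := by
    rw [lt_top_iff_ne_top]
    intro h
    have : star v ∈ orth v := h ▸ Submodule.mem_top
    exact hv (eq_zero_of_star_dotProduct_self this)
  simpa using Submodule.finrank_lt_finrank_of_lt this

/-- The triple product formula gives `(a × b) × ℓ = 0`, so `ℓ` is proportional to `a × b`. -/
theorem exists_rep_eq_smul_cross {ℓ : Plane} {a b : Fin 3 → ℂ} (h : LinearIndependent ℂ ![a, b])
    (ha : a ⬝ᵥ ℓ.rep = 0) (hb : b ⬝ᵥ ℓ.rep = 0) :
    ∃ s : ℂ, ℓ.rep = s • crossProduct a b := by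
  have hn := crossProduct_ne_zero_iff_linearIndependent.2 h
  by_contra hcon
  push Not at hcon
  have h2 : crossProduct (crossProduct a b) ℓ.rep ≠ 0 :=
    crossProduct_ne_zero_iff_linearIndependent.2
      ((LinearIndependent.pair_iff' hn).2 fun s hs => hcon s hs.symm)
  exact h2 (by rw [cross_cross_eq_smul_sub_smul, ha, hb, zero_smul, zero_smul, sub_zero])

theorem isImageLine_of_cross {C : Matrix (Fin 3) (Fin 4) ℂ} {L : Gr} {x y : Fin 4 → ℂ}
    (hL : L.1 = Submodule.span ℂ {x, y}) (h : crossProduct (C.mulVec x) (C.mulVec y) ≠ 0)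
    {ℓ : Plane} {s : ℂ} (hs : ℓ.rep = s • crossProduct (C.mulVec x) (C.mulVec y)) :
    IsImageLine C L ℓ := by
  have hli := crossProduct_ne_zero_iff_linearIndependent.1 h
  constructor
  · rw [eq_bot_iff, hL]
    rintro p ⟨hp, hpL⟩
    obtain ⟨a, b, rfl⟩ := Submodule.mem_span_pair.1 hpL
    have := mem_center.1 hp
    rw [Matrix.mulVec_add, Matrix.mulVec_smul, Matrix.mulVec_smul] at this
    obtain ⟨rfl, rfl⟩ := LinearIndependent.pair_iff.1 hli a b this
    simp
  · have hmap : L.1.map C.mulVecLin = Submodule.span ℂ {C.mulVec x, C.mulVec y} := by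
      rw [hL, Submodule.map_span, Set.image_pair]
      rfl
    rw [hmap]
    have hle : Submodule.span ℂ {C.mulVec x, C.mulVec y} ≤ orth ℓ.rep := by
      rw [Submodule.span_le]
      rintro v (rfl | rfl)
      · change _ ⬝ᵥ _ = _
        rw [hs, dotProduct_smul, dot_self_cross, smul_zero]
      · change _ ⬝ᵥ _ = _
        rw [hs, dotProduct_smul, dot_cross_self, smul_zero]
    refine Submodule.eq_of_le_of_finrank_le hle ?_
    have h2 := finrank_span_eq_card hli
    rw [Matrix.range_cons, Matrix.range_cons, Matrix.range_empty, Set.union_empty,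
      Set.singleton_union, Fintype.card_fin] at h2
    rw [h2]
    exact Nat.le_of_lt_succ (finrank_orth_lt ℓ.rep_nonzero)

theorem IsImageLine.le_backProjectedPlane {C : Matrix (Fin 3) (Fin 4) ℂ} {L : Gr} {ℓ : Plane}
    (h : IsImageLine C L ℓ) : L.1 ≤ backProjectedPlane C ℓ := by
  intro p hp
  have : C.mulVec p ∈ orth ℓ.rep := h.2 ▸ Submodule.mem_map_of_mem (f := C.mulVecLin) hp
  rw [mem_backProjectedPlane]
  exact this

theorem continuous_cross {f g : ℂ → Fin 3 → ℂ} (hf : Continuous f) (hg : Continuous g) :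
    Continuous fun t => crossProduct (f t) (g t) := by
  simp only [cross_apply]
  refine continuous_pi fun i => ?_
  fin_cases i <;> simp <;> fun_prop

/-! ### Deformations of a line and the limits of its images -/

/-- The point `x + t M x + t² N x`. -/
def perturb (M N : (Fin 4 → ℂ) →ₗ[ℂ] (Fin 4 → ℂ)) (t : ℂ) : (Fin 4 → ℂ) →ₗ[ℂ] (Fin 4 → ℂ) :=
  LinearMap.id + t • M + t ^ 2 • N

theorem mulVec_perturb (C : Matrix (Fin 3) (Fin 4) ℂ) (M N : (Fin 4 → ℂ) →ₗ[ℂ] (Fin 4 → ℂ))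
    (t : ℂ) (x : Fin 4 → ℂ) :
    C.mulVec (perturb M N t x) = C.mulVec x + t • C.mulVec (M x) + t ^ 2 • C.mulVec (N x) := by
  simp [perturb, Matrix.mulVec_add, Matrix.mulVec_smul]

theorem continuous_mulVec_perturb (C : Matrix (Fin 3) (Fin 4) ℂ)
    (M N : (Fin 4 → ℂ) →ₗ[ℂ] (Fin 4 → ℂ)) (x : Fin 4 → ℂ) :
    Continuous fun t => C.mulVec (perturb M N t x) := by
  simp_rw [mulVec_perturb]
  fun_prop

theorem linearIndependent_mulVec {C : Matrix (Fin 3) (Fin 4) ℂ} {L : Gr}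
    (hcL : center C ≤ L.1) {w z : Fin 4 → ℂ} (hw : w ∉ L.1) (hz : z ∈ L.1) (hzc : z ∉ center C) :
    LinearIndependent ℂ ![C.mulVec w, C.mulVec z] := by
  rw [LinearIndependent.pair_iff]
  intro a b h
  rw [← Matrix.mulVec_smul, ← Matrix.mulVec_smul, ← Matrix.mulVec_add] at h
  have ha : a = 0 := by
    by_contra ha
    have := L.1.sub_mem (hcL (mem_center.2 h)) (L.1.smul_mem b hz)
    rw [add_sub_cancel_right] at this
    exact hw ((L.1.smul_mem_iff ha).1 this)
  refine ⟨ha, ?_⟩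
  by_contra hb
  rw [ha, zero_smul, zero_add] at h
  exact hzc (((center C).smul_mem_iff hb).1 (mem_center.2 h))

/-- When `L` contains the center `c`, the normal of the image line vanishes at `t = 0` because `C c
= 0`. Dividing by the power of `t` at which `c` leaves `L` gives a nonzero limit. That limit is
proportional to `ℓ`, because the displacement of `c` and `L` itself lie in the back-projected plane.
-/
theorem exists_perturbed_normal {C : Matrix (Fin 3) (Fin 4) ℂ} (hC : C.rank = 3) {ℓ : Plane}
    {L : Gr} {x y : Fin 4 → ℂ} (hxy : LinearIndependent ℂ ![x, y])
    (hL : L.1 = Submodule.span ℂ {x, y})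
    (hLH : L.1 ≤ backProjectedPlane C ℓ) (M N : (Fin 4 → ℂ) →ₗ[ℂ] (Fin 4 → ℂ))
    (hMN : ∀ c ∈ center C, c ∈ L.1 → c ≠ 0 →
      (M c ∈ backProjectedPlane C ℓ ∧ M c ∉ L.1) ∨
        (M c = 0 ∧ N c ∈ backProjectedPlane C ℓ ∧ N c ∉ L.1)) :
    ∃ (P : ℂ → Fin 3 → ℂ) (r : ℕ), Continuous P ∧ P 0 ≠ 0 ∧ (∃ s : ℂ, ℓ.rep = s • P 0) ∧
      ∀ t, crossProduct (C.mulVec (perturb M N t x)) (C.mulVec (perturb M N t y)) = t ^ r • P t := by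
  by_cases hdis : center C ⊓ L.1 = ⊥
  · refine ⟨_, 0, continuous_cross (continuous_mulVec_perturb C M N x)
      (continuous_mulVec_perturb C M N y), ?_, ?_, fun t => by rw [pow_zero, one_smul]⟩
    all_goals
      have hli : LinearIndependent ℂ ![C.mulVec x, C.mulVec y] := by
        rw [LinearIndependent.pair_iff]
        intro a b h
        rw [← Matrix.mulVec_smul, ← Matrix.mulVec_smul, ← Matrix.mulVec_add] at h
        have : a • x + b • y ∈ center C ⊓ L.1 :=
          ⟨mem_center.2 h, hL ▸ Submodule.mem_span_pair.2 ⟨a, b, rfl⟩⟩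
        rw [hdis, Submodule.mem_bot] at this
        exact LinearIndependent.pair_iff.1 hxy a b this
      simp only [perturb, zero_smul, add_zero, LinearMap.id_apply, ne_eq, OfNat.ofNat_ne_zero,
        not_false_eq_true, zero_pow]
    · exact crossProduct_ne_zero_iff_linearIndependent.2 hli
    · exact exists_rep_eq_smul_cross hli
        (mem_backProjectedPlane.1 (hLH (hL ▸ Submodule.subset_span (by simp))))
        (mem_backProjectedPlane.1 (hLH (hL ▸ Submodule.subset_span (by simp))))
  · obtain ⟨c, ⟨hc, hcL⟩, hc0⟩ := (Submodule.ne_bot_iff _).1 hdis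
    obtain ⟨α, β, hαβ⟩ := Submodule.mem_span_pair.1 (hL ▸ hcL)
    -- Complete `c` to a basis `c, z` of `L` by a change of basis of determinant one, which leaves
    -- the cross product unchanged.
    obtain ⟨γ, δ, hdet⟩ : ∃ γ δ : ℂ, α * δ - β * γ = 1 := by
      by_cases hα : α = 0
      · have hβ : β ≠ 0 := by
          rintro rfl
          exact hc0 (by rw [← hαβ, hα]; simp)
        exact ⟨-β⁻¹, 0, by field_simp; ring⟩
      · exact ⟨0, α⁻¹, by field_simp; ring⟩
    set z := γ • x + δ • y with hz
    have hx : x = δ • c - β • z := by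
      calc x = (α * δ - β * γ) • x := by rw [hdet, one_smul]
        _ = _ := by rw [← hαβ, hz]; module
    have hy : y = α • z - γ • c := by
      calc y = (α * δ - β * γ) • y := by rw [hdet, one_smul]
        _ = _ := by rw [← hαβ, hz]; module
    have hzL : z ∈ L.1 := hL ▸ Submodule.mem_span_pair.2 ⟨γ, δ, rfl⟩
    have hcenter : center C ≤ L.1 := by
      rw [center_eq_span hC hc hc0, Submodule.span_singleton_le_iff_mem]
      exact hcL
    have hzc : z ∉ center C := by
      intro hzc
      have : L.1 ≤ center C := by
        rw [hL, Submodule.span_le]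
        rintro v (rfl | rfl)
        · rw [hx]
          exact sub_mem ((center C).smul_mem _ hc) ((center C).smul_mem _ hzc)
        · rw [hy]
          exact sub_mem ((center C).smul_mem _ hzc) ((center C).smul_mem _ hc)
      have := Submodule.finrank_mono this
      rw [L.2, finrank_center hC] at this
      omega
    have hcross : ∀ t, crossProduct (C.mulVec (perturb M N t x)) (C.mulVec (perturb M N t y)) =
        crossProduct (C.mulVec (perturb M N t c)) (C.mulVec (perturb M N t z)) := by
      intro t
      conv_lhs => rw [hx, hy]
      simp only [map_sub, map_smul, Matrix.mulVec_sub, Matrix.mulVec_smul, LinearMap.sub_apply,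
        LinearMap.smul_apply, cross_self, smul_zero]
      rw [← cross_anticomm (C.mulVec (perturb M N t c))]
      set v := crossProduct (C.mulVec (perturb M N t c)) (C.mulVec (perturb M N t z))
      calc _ = (α * δ - β * γ) • v := by module
        _ = v := by rw [hdet, one_smul]
    have hmain : ∀ w, w ∈ backProjectedPlane C ℓ → w ∉ L.1 →
        crossProduct (C.mulVec w) (C.mulVec z) ≠ 0 ∧
          ∃ s : ℂ, ℓ.rep = s • crossProduct (C.mulVec w) (C.mulVec z) := by
      intro w hw hwL
      have hli := linearIndependent_mulVec hcenter hwL hzL hzc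
      exact ⟨crossProduct_ne_zero_iff_linearIndependent.2 hli, exists_rep_eq_smul_cross hli
        (mem_backProjectedPlane.1 hw) (mem_backProjectedPlane.1 (hLH hzL))⟩
    rcases hMN c hc hcL hc0 with ⟨h1, h2⟩ | ⟨h0, h1, h2⟩
    · refine ⟨fun t => crossProduct (C.mulVec (M c) + t • C.mulVec (N c))
        (C.mulVec (perturb M N t z)), 1, continuous_cross (by fun_prop)
        (continuous_mulVec_perturb C M N z), ?_, ?_, fun t => ?_⟩
      · simpa [perturb] using (hmain _ h1 h2).1
      · simpa [perturb] using (hmain _ h1 h2).2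
      · rw [hcross, mulVec_perturb C M N t c, mem_center.1 hc, ← LinearMap.smul_apply, ← map_smul]
        congr 2
        module
    · refine ⟨fun t => crossProduct (C.mulVec (N c)) (C.mulVec (perturb M N t z)), 2,
        continuous_cross continuous_const (continuous_mulVec_perturb C M N z), ?_, ?_, fun t => ?_⟩
      · simpa [perturb] using (hmain _ h1 h2).1
      · simpa [perturb] using (hmain _ h1 h2).2
      · rw [hcross, mulVec_perturb C M N t c, mem_center.1 hc, h0, ← LinearMap.smul_apply,
          ← map_smul]
        congr 2
        simp

open Filter Topology in
-- There are finitely many cameras, so for small `t ≠ 0` all normals are nonzero at once: the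
-- deformed line misses every center and its image tuple tends to `ℓ`.
theorem mem_lineMultiviewVariety_of_perturbation {m : ℕ} {C : Fin m → Matrix (Fin 3) (Fin 4) ℂ}
    (hC : ∀ i, (C i).rank = 3) {ℓ : Fin m → Plane} {L : Gr}
    (hLH : ∀ i, L.1 ≤ backProjectedPlane (C i) (ℓ i)) (M N : (Fin 4 → ℂ) →ₗ[ℂ] (Fin 4 → ℂ))
    (hMN : ∀ i, ∀ c ∈ center (C i), c ∈ L.1 → c ≠ 0 →
      (M c ∈ backProjectedPlane (C i) (ℓ i) ∧ M c ∉ L.1) ∨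
        (M c = 0 ∧ N c ∈ backProjectedPlane (C i) (ℓ i) ∧ N c ∉ L.1)) :
    ℓ ∈ lineMultiviewVariety C := by
  -- Some camera `i₀` is needed below, since independence of the deformed spanning points is read
  -- off from one image.
  rcases isEmpty_or_nonempty (Fin m) with hm | ⟨⟨i₀⟩⟩
  · exact Set.mem_sInter.2 fun X hX => hX.2 ⟨L, fun i => hm.elim i⟩
  obtain ⟨x, y, hxy, hL⟩ := exists_basis_of_line L
  choose P r hP hP0 hs hr using fun i =>
    exists_perturbed_normal (hC i) hxy hL (hLH i) M N (hMN i)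
  refine mem_zariskiClosure_of_limit P hP hs ?_
  have hev : ∀ᶠ t in 𝓝[≠] (0 : ℂ), ∀ i, P i t ≠ 0 :=
    nhdsWithin_le_nhds (eventually_all.2 fun i => (hP i).continuousAt.eventually_ne (hP0 i))
  filter_upwards [hev, self_mem_nhdsWithin] with t ht ht0
  have hcross : ∀ i, crossProduct ((C i).mulVec (perturb M N t x))
      ((C i).mulVec (perturb M N t y)) ≠ 0 := fun i => by
    rw [hr]
    exact smul_ne_zero (pow_ne_zero _ ht0) (ht i)
  have hli : LinearIndependent ℂ ![perturb M N t x, perturb M N t y] := by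
    have := crossProduct_ne_zero_iff_linearIndependent.1 (hcross i₀)
    rw [LinearIndependent.pair_iff] at this ⊢
    intro a b h
    refine this a b ?_
    rw [← Matrix.mulVec_smul, ← Matrix.mulVec_smul, ← Matrix.mulVec_add, h, Matrix.mulVec_zero]
  have hrep : ∀ i, ∃ s : ℂ, s ≠ 0 ∧ (Projectivization.mk ℂ (P i t) (ht i)).rep = s • P i t :=
    fun i => by
      obtain ⟨a, ha⟩ := Projectivization.exists_smul_eq_mk_rep ℂ (P i t) (ht i)
      exact ⟨a, a.ne_zero, ha.symm⟩
  refine ⟨fun i => Projectivization.mk ℂ (P i t) (ht i),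
    ⟨⟨_, finrank_span_pair_of_linearIndependent hli⟩, fun i => ?_⟩, fun i => ?_⟩
  · obtain ⟨s, -, h⟩ := hrep i
    refine isImageLine_of_cross rfl (hcross i) (s := s * (t ^ r i)⁻¹) ?_
    rw [h, hr, smul_smul, mul_assoc, inv_mul_cancel₀ (pow_ne_zero _ ht0), mul_one]
  · obtain ⟨s, -, h⟩ := hrep i
    exact ⟨s, h⟩

/-! ### Bases adapted to a line and a complementary line -/

/-- The basis `b` consists of a basis of `E` and a basis of `D`. -/
def IsAdapted (b : Module.Basis (Fin 2 ⊕ Fin 2) ℂ (Fin 4 → ℂ)) (E D : Submodule ℂ (Fin 4 → ℂ)) :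
    Prop :=
  (∀ p, p ∈ E ↔ ∀ a, b.repr p (.inr a) = 0) ∧ ∀ p, p ∈ D ↔ ∀ a, b.repr p (.inl a) = 0

theorem exists_isAdapted {E D : Submodule ℂ (Fin 4 → ℂ)} (hE : Module.finrank ℂ E = 2)
    (hD : Module.finrank ℂ D = 2) (h : IsCompl E D) : ∃ b, IsAdapted b E D := by
  let bE := Module.finBasisOfFinrankEq ℂ E hE
  let bD := Module.finBasisOfFinrankEq ℂ D hD
  refine ⟨(bE.prod bD).map (Submodule.prodEquivOfIsCompl E D h), fun p => ?_, fun p => ?_⟩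
  · rw [← Submodule.prodEquivOfIsCompl_symm_apply_snd_eq_zero _ _ h, ← bD.repr.map_eq_zero_iff,
      Finsupp.ext_iff]
    rfl
  · rw [← Submodule.prodEquivOfIsCompl_symm_apply_fst_eq_zero _ _ h, ← bE.repr.map_eq_zero_iff,
      Finsupp.ext_iff]
    rfl

theorem isCompl_hermitianDual {E : Submodule ℂ (Fin 4 → ℂ)} (hE : Module.finrank ℂ E = 2) :
    IsCompl E (hermitianDual E) ∧ Module.finrank ℂ (hermitianDual E) = 2 := by
  have hdis : Disjoint E (hermitianDual E) := by
    rw [Submodule.disjoint_def]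
    exact fun p hp hp' => eq_zero_of_star_dotProduct_self (hp' p hp)
  obtain ⟨x, y, -, hxy⟩ := exists_basis_of_line ⟨E, hE⟩
  have hxy : E = Submodule.span ℂ {x, y} := hxy
  let g : (Fin 4 → ℂ) →ₗ[ℂ] (Fin 2 → ℂ) := (Matrix.of ![star x, star y]).mulVecLin
  have hker : LinearMap.ker g ≤ hermitianDual E := by
    intro p hp q hq
    have h0 : star x ⬝ᵥ p = 0 := congrFun (LinearMap.mem_ker.1 hp) 0
    have h1 : star y ⬝ᵥ p = 0 := congrFun (LinearMap.mem_ker.1 hp) 1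
    rw [hxy] at hq
    obtain ⟨a, c, rfl⟩ := Submodule.mem_span_pair.1 hq
    have h0' : star p ⬝ᵥ x = 0 := by
      rw [Matrix.star_dotProduct, h0, star_zero]
    have h1' : star p ⬝ᵥ y = 0 := by
      rw [Matrix.star_dotProduct, h1, star_zero]
    rw [dotProduct_add, dotProduct_smul, dotProduct_smul, h0', h1', smul_zero, smul_zero, add_zero]
  have h1 := LinearMap.finrank_range_add_finrank_ker g
  have h2 : Module.finrank ℂ (LinearMap.range g) ≤ 2 := by
    simpa using Submodule.finrank_le (LinearMap.range g)
  -- Two equations bound the dimension of the dual below by 2; disjointness from `E` bounds it above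
  -- by 2.
  have h3 := Submodule.finrank_mono hker
  have h4 := Submodule.finrank_add_finrank_le_of_disjoint hdis
  rw [Module.finrank_fintype_fun_eq_card, Fintype.card_fin] at h1 h4
  have h5 : Module.finrank ℂ (hermitianDual E) = 2 := by omega
  exact ⟨⟨hdis, codisjoint_iff.2 (Submodule.eq_top_of_disjoint E _ (by simp [hE, h5]) hdis)⟩, h5⟩

section Adapted

variable {b : Module.Basis (Fin 2 ⊕ Fin 2) ℂ (Fin 4 → ℂ)} {E D : Submodule ℂ (Fin 4 → ℂ)}

/-- The determinant of the first two coordinates. -/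
noncomputable def detForm (b : Module.Basis (Fin 2 ⊕ Fin 2) ℂ (Fin 4 → ℂ)) (c : Fin 4 → ℂ) :
    Module.Dual ℂ (Fin 4 → ℂ) :=
  b.repr c (.inl 0) • b.coord (.inl 1) - b.repr c (.inl 1) • b.coord (.inl 0)

theorem detForm_apply (c p : Fin 4 → ℂ) : detForm b c p =
    b.repr c (.inl 0) * b.repr p (.inl 1) - b.repr c (.inl 1) * b.repr p (.inl 0) := by
  simp [detForm]

/-- The projection to the span of the last two basis vectors. -/
noncomputable def projRight (b : Module.Basis (Fin 2 ⊕ Fin 2) ℂ (Fin 4 → ℂ)) :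
    (Fin 4 → ℂ) →ₗ[ℂ] (Fin 4 → ℂ) :=
  ∑ a, (b.coord (.inr a)).smulRight (b (.inr a))

theorem projRight_apply (p : Fin 4 → ℂ) :
    projRight b p = ∑ a, b.repr p (.inr a) • b (.inr a) := by
  simp [projRight]

theorem eq_sum_add_projRight (b : Module.Basis (Fin 2 ⊕ Fin 2) ℂ (Fin 4 → ℂ)) (p : Fin 4 → ℂ) :
    p = (∑ a, b.repr p (.inl a) • b (.inl a)) + projRight b p := by
  rw [projRight_apply]
  conv_lhs => rw [← b.sum_repr p, Fintype.sum_sum_type]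

theorem IsAdapted.projRight_mem (hb : IsAdapted b E D) (p : Fin 4 → ℂ) : projRight b p ∈ D := by
  rw [hb.2, projRight_apply]
  intro a
  simp

theorem IsAdapted.projRight_eq_self (hb : IsAdapted b E D) {p : Fin 4 → ℂ} (hp : p ∈ D) :
    projRight b p = p := by
  conv_rhs => rw [eq_sum_add_projRight b p]
  simp [(hb.2 p).1 hp]

theorem IsAdapted.projRight_eq_zero (hb : IsAdapted b E D) {p : Fin 4 → ℂ} (hp : p ∈ E) :
    projRight b p = 0 := by
  rw [projRight_apply]
  simp [(hb.1 p).1 hp]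

theorem IsAdapted.mem_of_projRight_eq_zero (hb : IsAdapted b E D) {p : Fin 4 → ℂ}
    (hp : projRight b p = 0) : p ∈ E := by
  rw [hb.1]
  intro a
  rw [eq_sum_add_projRight b p, hp]
  simp

/-- The linear form `p ↦ vᵀ p''`, where `p''` is the projection of `p` to the last two basis
vectors. -/
noncomputable def rightForm (b : Module.Basis (Fin 2 ⊕ Fin 2) ℂ (Fin 4 → ℂ)) (v : Fin 4 → ℂ) :
    Module.Dual ℂ (Fin 4 → ℂ) :=
  (dotProductBilin ℂ ℂ).flip v ∘ₗ projRight b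

theorem rightForm_apply (v p : Fin 4 → ℂ) : rightForm b v p = projRight b p ⬝ᵥ v := rfl

/-- The `E`-component must be a multiple of `c` and the `D`-component must be orthogonal to `v`;
these are two independent conditions on the two components. -/
theorem IsAdapted.mem_sup_iff (hb : IsAdapted b E D) {c v p : Fin 4 → ℂ} (hc : c ∈ E) (hc0 : c ≠ 0) :
    p ∈ Submodule.span ℂ {c} ⊔ (orth v ⊓ D) ↔ detForm b c p = 0 ∧ rightForm b v p = 0 := by
  rw [rightForm_apply]
  constructor
  · intro h
    obtain ⟨q, hq, r, ⟨hr, hrD⟩, rfl⟩ := Submodule.mem_sup.1 h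
    obtain ⟨a, rfl⟩ := Submodule.mem_span_singleton.1 hq
    have hr' := (hb.2 r).1 hrD
    constructor
    · simp only [detForm_apply, map_add, map_smul, hr', smul_eq_mul]
      ring
    · rw [map_add, map_smul, hb.projRight_eq_zero hc, smul_zero, zero_add, hb.projRight_eq_self hrD]
      exact hr
  · rintro ⟨h1, h2⟩
    obtain ⟨a, ha⟩ : ∃ a : ℂ, ∀ i, b.repr p (.inl i) = a * b.repr c (.inl i) := by
      rw [detForm_apply] at h1
      by_cases h0 : b.repr c (.inl 0) = 0
      · have h3 : b.repr c (.inl 1) ≠ 0 := by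
          intro h3
          apply hc0
          rw [← b.repr.map_eq_zero_iff]
          ext (i | i)
          · fin_cases i
            · exact h0
            · exact h3
          · exact (hb.1 c).1 hc i
        refine ⟨b.repr p (.inl 1) / b.repr c (.inl 1), fun i => ?_⟩
        fin_cases i
        · rw [h0, zero_mul, zero_sub, neg_eq_zero, mul_eq_zero, or_iff_right h3] at h1
          simp [h1, h0]
        · simp [h3]
      · refine ⟨b.repr p (.inl 0) / b.repr c (.inl 0), fun i => ?_⟩
        fin_cases i
        · simp [h0]
        · simp only [Fin.mk_one, Fin.isValue]
          field_simp
          linear_combination h1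
    refine Submodule.mem_sup.2 ⟨a • c, Submodule.smul_mem _ _ (Submodule.mem_span_singleton_self c),
      projRight b p, ⟨h2, hb.projRight_mem p⟩, ?_⟩
    conv_rhs => rw [eq_sum_add_projRight b p]
    conv_lhs => rw [eq_sum_add_projRight b c, hb.projRight_eq_zero hc]
    simp only [ha, mul_smul, ← Finset.smul_sum, add_zero]

/-- Two linear forms have a common nonzero zero on the plane `L` of `ℂ⁴` exactly when their 2 × 2
determinant in a basis vanishes. -/
theorem inf_ne_bot_iff {L : Gr} {x y : Fin 4 → ℂ} (hL : L.1 = Submodule.span ℂ {x, y})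
    {F : Submodule ℂ (Fin 4 → ℂ)} {h k : Module.Dual ℂ (Fin 4 → ℂ)}
    (hF : ∀ p, p ∈ F ↔ h p = 0 ∧ k p = 0) :
    L.1 ⊓ F ≠ ⊥ ↔ h x * k y - h y * k x = 0 := by
  have hli := linearIndependent_of_span_eq hL
  have hdet : h x * k y - h y * k x = Matrix.det !![h x, h y; k x, k y] := by
    rw [Matrix.det_fin_two_of]
  rw [hdet, ← Matrix.exists_mulVec_eq_zero_iff, Submodule.ne_bot_iff]
  constructor
  · rintro ⟨p, ⟨hp, hpF⟩, hp0⟩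
    obtain ⟨s, t, rfl⟩ := Submodule.mem_span_pair.1 (hL ▸ hp)
    refine ⟨![s, t], ?_, ?_⟩
    · intro h0
      have hs : s = 0 := congrFun h0 0
      have ht : t = 0 := congrFun h0 1
      exact hp0 (by simp [hs, ht])
    · obtain ⟨h1, h2⟩ := (hF _).1 hpF
      simp only [map_add, map_smul, smul_eq_mul] at h1 h2
      ext i
      fin_cases i <;> simp [Matrix.mulVec, dotProduct, Fin.sum_univ_two]
      · linear_combination h1
      · linear_combination h2
  · rintro ⟨u, hu0, hu⟩
    have h1 := congrFun hu 0
    have h2 := congrFun hu 1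
    simp only [Matrix.mulVec, dotProduct, Fin.sum_univ_two, Matrix.of_apply, Matrix.cons_val',
      Matrix.cons_val_zero, Matrix.cons_val_one, Matrix.cons_val_fin_one, Pi.zero_apply] at h1 h2
    refine ⟨u 0 • x + u 1 • y, ⟨hL ▸ Submodule.mem_span_pair.2 ⟨_, _, rfl⟩, (hF _).2 ⟨?_, ?_⟩⟩, ?_⟩
    · simp only [map_add, map_smul, smul_eq_mul]
      linear_combination h1
    · simp only [map_add, map_smul, smul_eq_mul]
      linear_combination h2
    · intro h0
      obtain ⟨h3, h4⟩ := LinearIndependent.pair_iff.1 hli _ _ h0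
      apply hu0
      ext i
      fin_cases i
      · exact h3
      · exact h4

theorem isGrVariety_schubert {F : Submodule ℂ (Fin 4 → ℂ)} {h k : Module.Dual ℂ (Fin 4 → ℂ)}
    (hF : ∀ p, p ∈ F ↔ h p = 0 ∧ k p = 0) : IsGrVariety (schubert F) := by
  convert isGrVariety_wedgeForms {(h, k)} using 1
  ext L
  obtain ⟨x, y, -, hL⟩ := exists_basis_of_line L
  simp only [Set.mem_singleton_iff, forall_eq, Set.mem_ofPred_eq]
  rw [vanishesAtLine_wedgeForm hL, ← inf_ne_bot_iff hL hF]
  rfl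

/-- The linear map from `E` to `D` attached to the line through `x` and `y`; if the line is the graph
of a linear map, this is a multiple of that map. -/
noncomputable def lineMap (b : Module.Basis (Fin 2 ⊕ Fin 2) ℂ (Fin 4 → ℂ)) (x y : Fin 4 → ℂ) :
    (Fin 4 → ℂ) →ₗ[ℂ] (Fin 4 → ℂ) :=
  -((detForm b x).smulRight (projRight b y)) + (detForm b y).smulRight (projRight b x)

theorem lineMap_apply (x y c : Fin 4 → ℂ) :
    lineMap b x y c = detForm b c x • projRight b y - detForm b c y • projRight b x := by
  have h : ∀ z, detForm b z c = -detForm b c z := fun z => by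
    rw [detForm_apply, detForm_apply]; ring
  simp only [lineMap, LinearMap.add_apply, LinearMap.neg_apply, LinearMap.smulRight_apply, h]
  module

theorem IsAdapted.lineMap_mem (hb : IsAdapted b E D) (x y c : Fin 4 → ℂ) : lineMap b x y c ∈ D := by
  rw [lineMap_apply]
  exact D.sub_mem (D.smul_mem _ (hb.projRight_mem _)) (D.smul_mem _ (hb.projRight_mem _))

theorem IsAdapted.lineMap_eq_zero (hb : IsAdapted b E D) (x y : Fin 4 → ℂ) {c : Fin 4 → ℂ}
    (hc : c ∈ D) : lineMap b x y c = 0 := by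
  rw [lineMap_apply]
  simp [detForm_apply, (hb.2 c).1 hc]

/-- By Cramer's identity the `E`-component of the right side cancels. The formula shows that the
value lies in the span of `c` and the line, hence in any plane containing both. -/
theorem IsAdapted.lineMap_eq (hb : IsAdapted b E D) (x y : Fin 4 → ℂ) {c : Fin 4 → ℂ} (hc : c ∈ E) :
    lineMap b x y c = detForm b c x • y - detForm b c y • x + detForm b x y • c := by
  rw [lineMap_apply, ← b.repr.injective.eq_iff]
  have hc' := (hb.1 c).1 hc
  have hl : ∀ p a, b.repr (projRight b p) (.inl a) = 0 := fun p => (hb.2 _).1 (hb.projRight_mem p)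
  have hr : ∀ p a, b.repr (projRight b p) (.inr a) = b.repr p (.inr a) := fun p a => by
    conv_rhs => rw [eq_sum_add_projRight b p]
    simp
  ext (a | a)
  · simp only [map_sub, map_add, map_smul, Finsupp.sub_apply, Finsupp.add_apply,
      Finsupp.smul_apply, hl, smul_eq_mul, detForm_apply]
    fin_cases a <;> simp <;> ring
  · simp [hr, hc']

theorem IsAdapted.lineMap_ne_zero (hb : IsAdapted b E D) {L : Gr} {x y : Fin 4 → ℂ}
    (hL : L.1 = Submodule.span ℂ {x, y}) (hE : ¬ L.1 ≤ E) (hD : ¬ L.1 ≤ D) :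
    lineMap b x y ≠ 0 := by
  intro h0
  have hli := linearIndependent_of_span_eq hL
  have hrel : ∀ a, b.repr x (.inl a) • projRight b y = b.repr y (.inl a) • projRight b x := by
    have h1 := LinearMap.congr_fun h0 (b (.inl 0))
    have h2 := LinearMap.congr_fun h0 (b (.inl 1))
    rw [lineMap_apply] at h1 h2
    simp only [detForm_apply, b.repr_self, Finsupp.single_eq_same, LinearMap.zero_apply,
      sub_eq_zero] at h1 h2
    intro a
    fin_cases a
    · simpa using h2
    · simpa using h1
  have key : ∀ a, b.repr x (.inl a) = 0 ∧ b.repr y (.inl a) = 0 := by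
    intro a
    have hw : b.repr x (.inl a) • y - b.repr y (.inl a) • x ∈ E := by
      apply hb.mem_of_projRight_eq_zero
      rw [map_sub, map_smul, map_smul, hrel, sub_self]
    by_contra hne
    -- If the determinant vanished, `x_a y - y_a x`, already in `E`, would also have zero
    -- `E`-coordinates, contradicting independence.
    have hdet : detForm b x y ≠ 0 := by
      intro hdet
      rw [detForm_apply] at hdet
      have : b.repr x (.inl a) • y - b.repr y (.inl a) • x = 0 := by
        rw [← b.repr.map_eq_zero_iff]
        ext (i | i)
        · simp only [map_sub, map_smul, Finsupp.sub_apply, Finsupp.smul_apply, smul_eq_mul,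
            Finsupp.zero_apply]
          fin_cases a <;> fin_cases i <;> simp only [Fin.zero_eta, Fin.mk_one]
          · ring
          · linear_combination hdet
          · linear_combination -hdet
          · ring
        · exact (hb.1 _).1 hw i
      have h3 := LinearIndependent.pair_iff.1 hli (-b.repr y (.inl a)) (b.repr x (.inl a))
        (by rw [← this]; module)
      exact hne ⟨h3.2, neg_eq_zero.1 h3.1⟩
    have hx : projRight b x = 0 := by
      have : detForm b x y • projRight b x = 0 := by
        rw [detForm_apply, sub_smul, mul_smul, mul_smul, ← hrel 1, ← hrel 0, smul_comm, sub_self]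
      exact (smul_eq_zero.1 this).resolve_left hdet
    have hy : projRight b y = 0 := by
      have : detForm b x y • projRight b y = 0 := by
        rw [detForm_apply, sub_smul, mul_comm, mul_smul, mul_comm, mul_smul, hrel 1, hrel 0,
          smul_comm, sub_self]
      exact (smul_eq_zero.1 this).resolve_left hdet
    apply hE
    rw [hL, Submodule.span_le]
    rintro v (rfl | rfl)
    · exact hb.mem_of_projRight_eq_zero hx
    · exact hb.mem_of_projRight_eq_zero hy
  apply hD
  rw [hL, Submodule.span_le]
  rintro v (rfl | rfl)
  · exact (hb.2 _).2 fun a => (key a).1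
  · exact (hb.2 _).2 fun a => (key a).2

end Adapted

/-! ### The exceptional locus -/

section Arrangement

variable {m : ℕ} {C : Fin m → Matrix (Fin 3) (Fin 4) ℂ} {I : Finset (Fin m)}

/-- There is a nonzero linear map from `E_I` to its dual that sends each center `c_i` into the
back-projected plane of `ℓ_i`. -/
def HasCompatibleMap (C : Fin m → Matrix (Fin 3) (Fin 4) ℂ) (I : Finset (Fin m))
    (ℓ : Fin m → Plane) : Prop :=
  ∃ φ : (Fin 4 → ℂ) →ₗ[ℂ] (Fin 4 → ℂ), φ ≠ 0 ∧ (∀ p, φ p ∈ hermitianDual (centerSpan C I)) ∧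
    (∀ p ∈ hermitianDual (centerSpan C I), φ p = 0) ∧
      ∀ i ∈ I, ∀ c ∈ center (C i), φ c ∈ backProjectedPlane (C i) (ℓ i)

theorem center_le_centerSpan (C : Fin m → Matrix (Fin 3) (Fin 4) ℂ) {i : Fin m} (hi : i ∈ I) :
    center (C i) ≤ centerSpan C I :=
  le_biSup (fun i => center (C i)) hi

theorem exists_isAdapted_centerSpan (hI : Module.finrank ℂ (centerSpan C I) = 2) :
    ∃ b, IsAdapted b (centerSpan C I) (hermitianDual (centerSpan C I)) :=
  exists_isAdapted hI (isCompl_hermitianDual hI).2 (isCompl_hermitianDual hI).1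

theorem mem_transversalSpace_iff {b : Module.Basis (Fin 2 ⊕ Fin 2) ℂ (Fin 4 → ℂ)}
    (hb : IsAdapted b (centerSpan C I) (hermitianDual (centerSpan C I))) (ℓ : Fin m → Plane)
    {i : Fin m} (hi : i ∈ I) (hC : (C i).rank = 3) {c : Fin 4 → ℂ} (hc : c ∈ center (C i))
    (hc0 : c ≠ 0) (p : Fin 4 → ℂ) : p ∈ transversalSpace C I ℓ i ↔
      detForm b c p = 0 ∧ rightForm b ((C i).transpose.mulVec (ℓ i).rep) p = 0 := by
  rw [transversalSpace, center_eq_span hC hc hc0, backProjectedPlane,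
    hb.mem_sup_iff (center_le_centerSpan C hi hc) hc0]

theorem exists_mem_center_ne_zero {C : Matrix (Fin 3) (Fin 4) ℂ} (hC : C.rank = 3) :
    ∃ c ∈ center C, c ≠ 0 := by
  obtain ⟨c, hc0, hc⟩ := exists_center_eq_span hC
  exact ⟨c, hc ▸ Submodule.mem_span_singleton_self c, hc0⟩

/-! ### Transversals and compatible maps -/

theorem isGrVariety_transversals (hC : ∀ i, (C i).rank = 3)
    (hI : Module.finrank ℂ (centerSpan C I) = 2) (ℓ : Fin m → Plane) :
    IsGrVariety (⋂ i ∈ I, schubert (transversalSpace C I ℓ i)) := by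
  obtain ⟨b, hb⟩ := exists_isAdapted_centerSpan hI
  refine IsGrVariety.iInter fun i => IsGrVariety.iInter fun hi => ?_
  obtain ⟨c, hc, hc0⟩ := exists_mem_center_ne_zero (hC i)
  exact isGrVariety_schubert (mem_transversalSpace_iff hb ℓ hi (hC i) hc hc0)

/-- Only `E_I` and its dual can have zero `lineMap`, so an infinite family has a useful member. For
it, the condition of meeting `F_I(ℓ_i)` literally says that `lineMap` sends `c_i` into the
back-projected plane. -/
theorem HasCompatibleMap.of_infinite (hC : ∀ i, (C i).rank = 3)
    (hI : Module.finrank ℂ (centerSpan C I) = 2) {ℓ : Fin m → Plane}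
    (h : (⋂ i ∈ I, schubert (transversalSpace C I ℓ i)).Infinite) : HasCompatibleMap C I ℓ := by
  obtain ⟨b, hb⟩ := exists_isAdapted_centerSpan hI
  obtain ⟨L, hLZ, hL⟩ := (h.sdiff (Set.toFinite {(⟨_, hI⟩ : Gr),
    ⟨_, (isCompl_hermitianDual hI).2⟩})).nonempty
  simp only [Set.mem_insert_iff, Set.mem_singleton_iff, not_or] at hL
  obtain ⟨x, y, -, hxy⟩ := exists_basis_of_line L
  refine ⟨lineMap b x y, hb.lineMap_ne_zero hxy
    (fun hle => hL.1 (Subtype.ext (Submodule.eq_of_le_of_finrank_eq hle (L.2.trans hI.symm))))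
    (fun hle => hL.2 (Subtype.ext (Submodule.eq_of_le_of_finrank_eq hle
      (L.2.trans (isCompl_hermitianDual hI).2.symm)))),
    hb.lineMap_mem x y, fun p hp => hb.lineMap_eq_zero x y hp, fun i hi c hc => ?_⟩
  rcases eq_or_ne c 0 with rfl | hc0
  · rw [map_zero]
    exact zero_mem _
  have hLi := Set.mem_iInter₂.1 hLZ i hi
  rw [schubert, Set.mem_ofPred_eq,
    inf_ne_bot_iff hxy (mem_transversalSpace_iff hb ℓ hi (hC i) hc hc0),
    rightForm_apply, rightForm_apply] at hLi
  rw [backProjectedPlane, mem_orth, lineMap_apply, sub_dotProduct, smul_dotProduct,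
    smul_dotProduct]
  exact hLi

/-- The graphs of `s φ` over `E_I`, for `s ∈ ℂ`, are distinct transversals: each contains `c_i + s φ
c_i`, a point of `F_I(ℓ_i)`. -/
theorem HasCompatibleMap.infinite (hC : ∀ i, (C i).rank = 3)
    (hI : Module.finrank ℂ (centerSpan C I) = 2) {ℓ : Fin m → Plane}
    (h : HasCompatibleMap C I ℓ) : (⋂ i ∈ I, schubert (transversalSpace C I ℓ i)).Infinite := by
  obtain ⟨φ, hφ0, hφD, hDφ, hφ⟩ := h
  have hcompl := (isCompl_hermitianDual hI).1
  let g : ℂ → (Fin 4 → ℂ) →ₗ[ℂ] (Fin 4 → ℂ) := fun s => LinearMap.id + s • φ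
  have hg : ∀ s p, g s p = p + s • φ p := fun _ _ => rfl
  have hinj : ∀ s : ℂ, Function.Injective (g s) := by
    intro s p q hpq
    -- Since `φ` maps into the dual and kills it, `φ² = 0`.
    have h1 : φ p = φ q := by
      have := congrArg φ hpq
      simpa [hg, hDφ _ (hφD _)] using this
    simpa [hg, h1] using hpq
  let T : ℂ → Gr := fun s => ⟨(centerSpan C I).map (g s), by
    rw [← hI]
    exact ((centerSpan C I).equivMapOfInjective _ (hinj s)).finrank_eq.symm⟩
  refine Set.infinite_of_injective_forall_mem (f := T) (fun s t hst => ?_) fun s => ?_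
  · obtain ⟨e, heE, he⟩ : ∃ e ∈ centerSpan C I, φ e ≠ 0 := by
      by_contra! hcon
      refine hφ0 (LinearMap.ext fun p => ?_)
      obtain ⟨q, hq, r, hr, rfl⟩ := Submodule.mem_sup.1
        (hcompl.sup_eq_top ▸ Submodule.mem_top : p ∈ centerSpan C I ⊔ _)
      rw [map_add, hcon q hq, hDφ r hr, add_zero, LinearMap.zero_apply]
    have hmem : g s e ∈ (T t).1 := by
      rw [← hst]
      exact Submodule.mem_map_of_mem heE
    obtain ⟨e', he'E, he'⟩ := hmem
    rw [hg, hg] at he'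
    have h1 : e' - e = s • φ e - t • φ e' := by
      rw [sub_eq_sub_iff_add_eq_add, he', add_comm]
    have h2 : e' - e = 0 := Submodule.disjoint_def.1 hcompl.disjoint _
      (sub_mem he'E heE) (h1 ▸ sub_mem (Submodule.smul_mem _ _ (hφD _))
        (Submodule.smul_mem _ _ (hφD _)))
    rw [sub_eq_zero.1 h2, sub_self, ← sub_smul] at h1
    exact sub_eq_zero.1 ((smul_eq_zero.1 h1.symm).resolve_right he)
  · refine Set.mem_iInter₂.2 fun i hi => (Submodule.ne_bot_iff _).2 ?_
    obtain ⟨c, hc, hc0⟩ := exists_mem_center_ne_zero (hC i)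
    refine ⟨g s c,
      ⟨Submodule.mem_map_of_mem (center_le_centerSpan C hi hc), ?_⟩,
      fun h0 => hc0 (hinj s (h0.trans (map_zero _).symm))⟩
    exact Submodule.add_mem_sup hc ((Submodule.smul_mem _ s ⟨hφ i hi c hc, hφD c⟩))

theorem mem_exceptionalLocusAt_iff (hC : ∀ i, (C i).rank = 3)
    (hI : Module.finrank ℂ (centerSpan C I) = 2) {ℓ : Fin m → Plane} :
    ℓ ∈ exceptionalLocusAt C I ↔ HasCompatibleMap C I ℓ := by
  rw [exceptionalLocusAt, Set.mem_ofPred_eq, one_le_grDim_iff (isGrVariety_transversals hC hI ℓ)]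
  exact ⟨.of_infinite hC hI, fun h => h.infinite hC hI⟩

theorem isVariety_hasCompatibleMap (hI : Module.finrank ℂ (centerSpan C I) = 2)
    (hC : ∀ i, (C i).rank = 3) : IsVariety {ℓ | HasCompatibleMap C I ℓ} := by
  obtain ⟨b, hb⟩ := exists_isAdapted_centerSpan hI
  choose c hc hc0 using fun i => exists_mem_center_ne_zero (hC i)
  -- The unknowns are the four matrix entries of `φ : E_I → E_I*`; the condition at `c_i` is linear
  -- in them, with coefficients linear in `ℓ_i`.
  let R : I → Fin 2 × Fin 2 → MvPolynomial (Fin m × Fin 3) ℂ := fun i k =>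
    groupForm i.1 (b.repr (c i) (.inl k.1) • (C i).mulVec (b (.inr k.2)))
  convert isVariety_linearSystem R (fun i => Pi.single i.1 1)
    (fun i k => isWeightedHomogeneous_groupForm _ _) using 1
  ext ℓ
  simp only [Set.mem_ofPred_eq, R, eval_groupForm]
  constructor
  · rintro ⟨φ, hφ0, hφD, hDφ, hφ⟩
    have hexp : ∀ p, φ p = ∑ k : Fin 2 × Fin 2,
        b.repr p (.inl k.1) • b.repr (φ (b (.inl k.1))) (.inr k.2) • b (.inr k.2) := by
      intro p
      conv_lhs => rw [eq_sum_add_projRight b p]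
      rw [map_add, hDφ _ (hb.projRight_mem p), add_zero, map_sum, Fintype.sum_prod_type]
      refine Finset.sum_congr rfl fun a _ => ?_
      simp only
      rw [map_smul, ← Finset.smul_sum, ← projRight_apply, hb.projRight_eq_self (hφD _)]
    refine ⟨fun k => b.repr (φ (b (.inl k.1))) (.inr k.2), fun h0 => hφ0 ?_, fun i => ?_⟩
    · refine LinearMap.ext fun p => ?_
      rw [hexp]
      have := fun k => congrFun h0 k
      simp only [Pi.zero_apply] at this
      simp [this]
    · have := mem_backProjectedPlane.1 (hφ i i.2 _ (hc i))
      rw [hexp, Matrix.mulVec_sum, sum_dotProduct] at this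
      rw [dotProduct, ← this]
      refine Finset.sum_congr rfl fun k _ => ?_
      simp only [Matrix.mulVec_smul, smul_dotProduct, smul_eq_mul]
      ring
  · rintro ⟨x, hx0, hx⟩
    let φ : (Fin 4 → ℂ) →ₗ[ℂ] (Fin 4 → ℂ) :=
      ∑ k : Fin 2 × Fin 2, x k • (b.coord (.inl k.1)).smulRight (b (.inr k.2))
    have hφ : ∀ p, φ p = ∑ k : Fin 2 × Fin 2,
        x k • b.repr p (.inl k.1) • b (.inr k.2) := by
      intro p
      simp [φ]
    refine ⟨φ, fun h0 => hx0 ?_, fun p => ?_, fun p hp => ?_, fun i hi d hd => ?_⟩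
    · ext ⟨a, a'⟩
      have := hφ (b (.inl a))
      rw [h0, LinearMap.zero_apply, Fintype.sum_prod_type, Finset.sum_eq_single a] at this
      · have := congrArg (fun v => b.repr v (.inr a')) this
        fin_cases a' <;> simpa [eq_comm, Finsupp.single_apply] using this
      · intro a'' _ hne
        simp [hne.symm]
      · simp
    · rw [hφ]
      refine Submodule.sum_mem _ fun k _ => Submodule.smul_mem _ _ (Submodule.smul_mem _ _ ?_)
      rw [hb.2]
      simp
    · rw [hφ]
      simp [(hb.2 p).1 hp]
    · rw [center_eq_span (hC i) (hc i) (hc0 i)] at hd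
      obtain ⟨s, rfl⟩ := Submodule.mem_span_singleton.1 hd
      rw [map_smul]
      refine Submodule.smul_mem _ _ (mem_backProjectedPlane.2 ?_)
      rw [hφ, Matrix.mulVec_sum, sum_dotProduct, ← hx ⟨i, hi⟩, dotProduct]
      refine Finset.sum_congr rfl fun k _ => ?_
      simp only [Matrix.mulVec_smul, smul_dotProduct, smul_eq_mul]
      ring

/-- The line `L` misses the centers, so it is not `E_I`. If it is the dual line, any map into the
dual is compatible, as `L` lies in all back-projected planes; otherwise `lineMap` is. -/
theorem hasCompatibleMap_of_mem_jointImage (hI : Module.finrank ℂ (centerSpan C I) = 2)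
    (hC : ∀ i, (C i).rank = 3) {ℓ : Fin m → Plane} (hℓ : ℓ ∈ jointImage C) :
    HasCompatibleMap C I ℓ := by
  obtain ⟨L, hL⟩ := hℓ
  obtain ⟨b, hb⟩ := exists_isAdapted_centerSpan hI
  by_cases hLD : L.1 ≤ hermitianDual (centerSpan C I)
  · have hLD : L.1 = hermitianDual (centerSpan C I) :=
      Submodule.eq_of_le_of_finrank_eq hLD (L.2.trans (isCompl_hermitianDual hI).2.symm)
    have hmem : b (.inr 0) ∈ hermitianDual (centerSpan C I) := by
      rw [hb.2]
      simp
    refine ⟨(b.coord (.inl 0)).smulRight (b (.inr 0)), fun h0 => ?_, fun p => ?_, fun p hp => ?_,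
      fun i hi c hc => ?_⟩
    · have := LinearMap.congr_fun h0 (b (.inl 0))
      simp [b.ne_zero] at this
    · exact Submodule.smul_mem _ _ hmem
    · simp [(hb.2 p).1 hp]
    · exact Submodule.smul_mem _ _ ((hL i).le_backProjectedPlane (hLD ▸ hmem))
  · obtain ⟨x, y, -, hxy⟩ := exists_basis_of_line L
    have hIne : I.Nonempty := by
      rw [Finset.nonempty_iff_ne_empty]
      rintro rfl
      have h0 : centerSpan C ∅ = ⊥ := by simp [centerSpan]
      rw [h0, finrank_bot] at hI
      omega
    obtain ⟨j, hj⟩ := hIne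
    refine ⟨lineMap b x y, hb.lineMap_ne_zero hxy (fun hle => ?_) hLD, hb.lineMap_mem x y,
      fun p hp => hb.lineMap_eq_zero x y hp, fun i hi c hc => ?_⟩
    · have hLE := Submodule.eq_of_le_of_finrank_eq hle (L.2.trans hI.symm)
      obtain ⟨c, hc, hc0⟩ := exists_mem_center_ne_zero (hC j)
      have : c ∈ center (C j) ⊓ L.1 := ⟨hc, hLE ▸ center_le_centerSpan C hj hc⟩
      rw [(hL j).1] at this
      exact hc0 this
    · have hx : x ∈ L.1 := hxy ▸ Submodule.subset_span (by simp)
      have hy : y ∈ L.1 := hxy ▸ Submodule.subset_span (by simp)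
      rw [hb.lineMap_eq x y (center_le_centerSpan C hi hc)]
      exact add_mem (sub_mem (Submodule.smul_mem _ _ ((hL i).le_backProjectedPlane hy))
        (Submodule.smul_mem _ _ ((hL i).le_backProjectedPlane hx)))
        (Submodule.smul_mem _ _ (center_le_backProjectedPlane _ _ hc))

/-! ### The rank condition -/

theorem rank_imageMatrix_le_two_iff {ℓ : Fin m → Plane} : (imageMatrix C ℓ).rank ≤ 2 ↔
    2 ≤ Module.finrank ℂ (⨅ i, backProjectedPlane (C i) (ℓ i) : Submodule ℂ (Fin 4 → ℂ)) := by
  have hker : LinearMap.ker (imageMatrix C ℓ).transpose.mulVecLin =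
      ⨅ i, backProjectedPlane (C i) (ℓ i) := by
    ext p
    rw [Submodule.mem_iInf, LinearMap.mem_ker, Matrix.mulVecLin_apply, funext_iff]
    refine forall_congr' fun i => ?_
    rw [backProjectedPlane, mem_orth, dotProduct_comm]
    rfl
  have := LinearMap.finrank_range_add_finrank_ker (imageMatrix C ℓ).transpose.mulVecLin
  rw [← Matrix.rank, Matrix.rank_transpose, hker, Module.finrank_fintype_fun_eq_card,
    Fintype.card_fin] at this
  omega

/-- This turns a dimension bound into solvability of a linear system for each `w`, the form in which
closedness can be read off. If `K` is spanned by one vector `v`, testing with its conjugate fails.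
-/
theorem two_le_finrank_iff (K : Submodule ℂ (Fin 4 → ℂ)) :
    2 ≤ Module.finrank ℂ K ↔ ∀ w : Fin 4 → ℂ, ∃ x ≠ 0, x ∈ K ∧ w ⬝ᵥ x = 0 := by
  constructor
  · intro h w
    by_contra! hcon
    have hinj : Function.Injective ((dotProductBilin ℂ ℂ w) ∘ₗ K.subtype) := by
      rw [injective_iff_map_eq_zero]
      intro x hx
      by_contra hx0
      exact hcon x (by simpa using hx0) x.2 hx
    have := LinearMap.finrank_le_finrank_of_injective hinj
    rw [Module.finrank_self] at this
    omega
  · intro h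
    by_contra hlt
    obtain ⟨v, hv⟩ := finrank_le_one_iff.1 (by omega : Module.finrank ℂ K ≤ 1)
    obtain ⟨x, hx0, hxK, hx⟩ := h (star v.1)
    obtain ⟨a, ha⟩ := hv ⟨x, hxK⟩
    have ha : a • v.1 = x := congrArg Subtype.val ha
    rw [← ha, dotProduct_smul, smul_eq_mul, mul_eq_zero] at hx
    rcases hx with rfl | hx
    · exact hx0 (by rw [← ha, zero_smul])
    · exact hx0 (by rw [← ha, eq_zero_of_star_dotProduct_self hx, smul_zero])

theorem isVariety_exists_mem_of_dotProduct (C : Fin m → Matrix (Fin 3) (Fin 4) ℂ) (w : Fin 4 → ℂ) :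
    IsVariety {ℓ | ∃ x ≠ 0, x ∈ (⨅ i, backProjectedPlane (C i) (ℓ i)) ∧ w ⬝ᵥ x = 0} := by
  -- The row `none` is the constant equation `w`, of multidegree 0.
  let R : Option (Fin m) → Fin 4 → MvPolynomial (Fin m × Fin 3) ℂ := fun a k =>
    a.elim (MvPolynomial.C (w k)) fun i => groupForm i fun j => C i j k
  convert isVariety_linearSystem R (fun a => a.elim 0 fun i => Pi.single i 1) ?_ using 1
  · ext ℓ
    simp only [Set.mem_ofPred_eq]
    refine exists_congr fun x => and_congr_right fun _ => ?_
    rw [Option.forall, and_comm, Submodule.mem_iInf]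
    refine and_congr ?_ (forall_congr' fun i => ?_)
    · simp [R]
    · rw [backProjectedPlane, mem_orth, dotProduct_comm]
      simp only [R, Option.elim_some, eval_groupForm]
      rfl
  · rintro (_ | i) k
    · exact MvPolynomial.isWeightedHomogeneous_C _ _
    · exact isWeightedHomogeneous_groupForm _ _

theorem lineMultiviewVariety_subset (hC : ∀ i, (C i).rank = 3) :
    lineMultiviewVariety C ⊆ {ℓ | (imageMatrix C ℓ).rank ≤ 2} ∩ exceptionalLocus C := by
  intro ℓ hℓ
  refine ⟨?_, Set.mem_iInter₂.2 fun I hI => ?_⟩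
  · rw [Set.mem_ofPred_eq, rank_imageMatrix_le_two_iff, two_le_finrank_iff]
    intro w
    refine zariskiClosure_subset (isVariety_exists_mem_of_dotProduct C w) ?_ hℓ
    rintro ℓ' ⟨L, hL⟩
    obtain ⟨x, hx0, hxL, hx⟩ := (two_le_finrank_iff L.1).1 L.2.ge w
    exact ⟨x, hx0, Submodule.mem_iInf _ |>.2 fun i => (hL i).le_backProjectedPlane hxL, hx⟩
  · rw [mem_exceptionalLocusAt_iff hC hI]
    exact zariskiClosure_subset (isVariety_hasCompatibleMap hI hC)
      (fun ℓ' h => hasCompatibleMap_of_mem_jointImage hI hC h) hℓ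

end Arrangement

/-! ### Points of the exceptional locus are limits of image tuples -/

section Arrangement

variable {m : ℕ} {C : Fin m → Matrix (Fin 3) (Fin 4) ℂ}

theorem linearIndependent_of_center_ne {A B : Matrix (Fin 3) (Fin 4) ℂ} (hA : A.rank = 3)
    (hB : B.rank = 3) (h : center A ≠ center B) {c d : Fin 4 → ℂ} (hc : c ∈ center A) (hc0 : c ≠ 0)
    (hd : d ∈ center B) (hd0 : d ≠ 0) : LinearIndependent ℂ ![c, d] := by
  rw [LinearIndependent.pair_iff' hc0]
  rintro a rfl
  exact h (by rw [center_eq_span hA (Submodule.smul_mem _ a hc) hd0, center_eq_span hB hd hd0])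

theorem exists_mem_backProjectedPlane_notMem (A : Matrix (Fin 3) (Fin 4) ℂ) (ℓ : Plane) (L : Gr) :
    ∃ w ∈ backProjectedPlane A ℓ, w ∉ L.1 := by
  by_contra! hle
  have h1 := Submodule.finrank_mono (show backProjectedPlane A ℓ ≤ L.1 from hle)
  have hker : backProjectedPlane A ℓ =
      LinearMap.ker ((dotProductBilin ℂ ℂ).flip (A.transpose.mulVec ℓ.rep)) := rfl
  have h2 := LinearMap.finrank_range_add_finrank_ker
    ((dotProductBilin ℂ ℂ).flip (A.transpose.mulVec ℓ.rep) : (Fin 4 → ℂ) →ₗ[ℂ] ℂ)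
  have h3 := Submodule.finrank_le (LinearMap.range
    ((dotProductBilin ℂ ℂ).flip (A.transpose.mulVec ℓ.rep) : (Fin 4 → ℂ) →ₗ[ℂ] ℂ))
  rw [← hker, Module.finrank_fintype_fun_eq_card, Fintype.card_fin] at h2
  rw [Module.finrank_self] at h3
  rw [L.2] at h1
  omega

theorem exists_line_le {K : Submodule ℂ (Fin 4 → ℂ)} (hK : 2 ≤ Module.finrank ℂ K) :
    ∃ L : Gr, L.1 ≤ K := by
  obtain ⟨f, hf⟩ := exists_linearIndependent_of_le_finrank hK
  refine ⟨⟨Submodule.span ℂ (Set.range (K.subtype ∘ f)), ?_⟩, ?_⟩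
  · simpa using finrank_span_eq_card (hf.map' K.subtype (Submodule.ker_subtype _))
  · rw [Submodule.span_le]
    rintro _ ⟨i, rfl⟩
    exact (f i).2

theorem subset_lineMultiviewVariety (hC : ∀ i, (C i).rank = 3)
    (hcenters : Function.Injective fun i => center (C i)) :
    {ℓ | (imageMatrix C ℓ).rank ≤ 2} ∩ exceptionalLocus C ⊆ lineMultiviewVariety C := by
  classical
  rintro ℓ ⟨hrank, hexc⟩
  obtain ⟨L, hLK⟩ := exists_line_le (rank_imageMatrix_le_two_iff.1 hrank)
  have hLH : ∀ i, L.1 ≤ backProjectedPlane (C i) (ℓ i) := fun i => hLK.trans (iInf_le _ i)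
  choose c hc hc0 using fun i => exists_mem_center_ne_zero (hC i)
  -- A functional nonzero on all centers lets `h.smulRight w` push every center in the direction of
  -- `w`.
  obtain ⟨h, hh⟩ := Module.exists_dual_forall_apply_ne_zero (K := ℂ) c hc0
  have hscale : ∀ i, ∀ d ∈ center (C i), d ∈ L.1 → d ≠ 0 → c i ∈ L.1 ∧ h d ≠ 0 := by
    intro i d hd hdL hd0
    rw [center_eq_span (hC i) (hc i) (hc0 i)] at hd
    obtain ⟨a, rfl⟩ := Submodule.mem_span_singleton.1 hd
    have ha : a ≠ 0 := by
      rintro rfl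
      simp at hd0
    exact ⟨(L.1.smul_mem_iff ha).1 hdL, by simpa using ⟨ha, hh i⟩⟩
  let I : Finset (Fin m) := Finset.univ.filter fun i => c i ∈ L.1
  have hmemI : ∀ i, i ∈ I ↔ c i ∈ L.1 := fun i => by simp [I]
  have hEL : centerSpan C I ≤ L.1 := by
    refine iSup₂_le fun i hi => ?_
    rw [center_eq_span (hC i) (hc i) (hc0 i), Submodule.span_singleton_le_iff_mem]
    exact (hmemI i).1 hi
  have hspan : ∀ i ∈ I, ∀ j ∈ I, i ≠ j → centerSpan C I = L.1 ∧
      ∀ u ∈ center (C i), ∀ v ∈ center (C j), u ≠ 0 → v ≠ 0 → L.1 = Submodule.span ℂ {u, v} := by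
    intro i hi j hj hij
    have hgen : ∀ u ∈ center (C i), ∀ v ∈ center (C j), u ≠ 0 → v ≠ 0 →
        Submodule.span ℂ {u, v} ≤ centerSpan C I ∧ Module.finrank ℂ (Submodule.span ℂ {u, v}) = 2 := by
      intro u hu v hv hu0 hv0
      refine ⟨?_, finrank_span_pair_of_linearIndependent (linearIndependent_of_center_ne (hC i)
        (hC j) (fun h => hij (hcenters h)) hu hu0 hv hv0)⟩
      rw [Submodule.span_le]
      rintro w (rfl | rfl)
      · exact center_le_centerSpan C hi hu
      · exact center_le_centerSpan C hj hv
    refine ⟨?_, fun u hu v hv hu0 hv0 => ?_⟩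
    · obtain ⟨h1, h2⟩ := hgen _ (hc i) _ (hc j) (hc0 i) (hc0 j)
      refine Submodule.eq_of_le_of_finrank_le hEL ?_
      rw [L.2, ← h2]
      exact Submodule.finrank_mono h1
    · obtain ⟨h1, h2⟩ := hgen u hu v hv hu0 hv0
      exact (Submodule.eq_of_le_of_finrank_eq (h1.trans hEL) (h2.trans L.2.symm)).symm
  by_cases hsub : ∃ i ∈ I, ∃ j ∈ I, i ≠ j
  · obtain ⟨i₀, hi₀, j₀, hj₀, hij₀⟩ := hsub
    have hE : centerSpan C I = L.1 := (hspan i₀ hi₀ j₀ hj₀ hij₀).1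
    have hI : Module.finrank ℂ (centerSpan C I) = 2 := hE ▸ L.2
    obtain ⟨hcompl, hD⟩ := isCompl_hermitianDual hI
    have hnot : ∀ q ∈ hermitianDual (centerSpan C I), q ≠ 0 → q ∉ L.1 := fun q hq hq0 hqL =>
      hq0 (Submodule.disjoint_def.1 hcompl.disjoint q (hE ▸ hqL) hq)
    obtain ⟨φ, hφ0, hφD, hDφ, hφ⟩ :=
      (mem_exceptionalLocusAt_iff hC hI).1 (Set.mem_iInter₂.1 hexc I hI)
    by_cases hker : ∃ j ∈ I, ∃ u ∈ center (C j), u ≠ 0 ∧ φ u = 0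
    · obtain ⟨j, hj, u, hu, hu0, hφu⟩ := hker
      -- The dual line meets the back-projected plane of `ℓ j`; this gives the second-order
      -- direction for the center that `φ` kills.
      obtain ⟨q, hq0, hqD, hq⟩ := (two_le_finrank_iff _).1 hD.ge ((C j).transpose.mulVec (ℓ j).rep)
      have hqH : q ∈ backProjectedPlane (C j) (ℓ j) := by
        rwa [backProjectedPlane, mem_orth, dotProduct_comm]
      refine mem_lineMultiviewVariety_of_perturbation hC hLH φ (h.smulRight q)
        fun i d hd hdL hd0 => ?_
      obtain ⟨hiL, hhd⟩ := hscale i d hd hdL hd0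
      have hi : i ∈ I := (hmemI i).2 hiL
      by_cases hφd : φ d = 0
      -- Two distinct centers span `L = E_I`, so a nonzero `φ` kills at most one of them, and `q`
      -- only has to suit `j`.
      · have hij : i = j := by
          by_contra hij
          have hLspan := (hspan i hi j hj hij).2 d hd u hu hd0 hu0
          refine hφ0 (LinearMap.ext fun p => ?_)
          obtain ⟨e, he, r, hr, rfl⟩ := Submodule.mem_sup.1
            (hcompl.sup_eq_top ▸ Submodule.mem_top : p ∈ centerSpan C I ⊔ _)
          rw [hE, hLspan] at he
          obtain ⟨a, b, rfl⟩ := Submodule.mem_span_pair.1 he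
          simp [hφd, hφu, hDφ r hr]
        subst hij
        exact Or.inr ⟨hφd, Submodule.smul_mem _ _ hqH, hnot _ (Submodule.smul_mem _ _ hqD)
          (smul_ne_zero hhd hq0)⟩
      · exact Or.inl ⟨hφ i hi d hd, hnot _ (hφD d) hφd⟩
    · push Not at hker
      refine mem_lineMultiviewVariety_of_perturbation hC hLH φ 0 fun i d hd hdL hd0 => Or.inl ?_
      have hi : i ∈ I := (hmemI i).2 (hscale i d hd hdL hd0).1
      exact ⟨hφ i hi d hd, hnot _ (hφD d) (hker i hi d hd hd0)⟩
  · push Not at hsub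
    -- With at most one center on `L`, a single first-order direction suffices and the exceptional
    -- locus plays no role.
    obtain ⟨w, hw⟩ : ∃ w, ∀ i ∈ I, w ∈ backProjectedPlane (C i) (ℓ i) ∧ w ∉ L.1 := by
      rcases I.eq_empty_or_nonempty with hI | ⟨j, hj⟩
      · exact ⟨0, by simp [hI]⟩
      · obtain ⟨w, hwH, hwL⟩ := exists_mem_backProjectedPlane_notMem (C j) (ℓ j) L
        refine ⟨w, fun i hi => ?_⟩
        rw [hsub i hi j hj]
        exact ⟨hwH, hwL⟩
    refine mem_lineMultiviewVariety_of_perturbation hC hLH (h.smulRight w) 0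
      fun i d hd hdL hd0 => Or.inl ?_
    obtain ⟨hiL, hhd⟩ := hscale i d hd hdL hd0
    obtain ⟨hwH, hwL⟩ := hw i ((hmemI i).2 hiL)
    exact ⟨Submodule.smul_mem _ _ hwH, fun hmem => hwL ((L.1.smul_mem_iff hhd).1 hmem)⟩

end Arrangement

end LineMultiview

theorem theorem2p6 {m : ℕ} (C : Fin m → Matrix (Fin 3) (Fin 4) ℂ)
    (hrank : ∀ i, (C i).rank = 3)
    (hcenters : Function.Injective fun i => LineMultiview.center (C i)) :
    LineMultiview.lineMultiviewVariety C =
      {ℓ | (LineMultiview.imageMatrix C ℓ).rank ≤ 2} ∩ LineMultiview.exceptionalLocus C :=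
  (LineMultiview.lineMultiviewVariety_subset hrank).antisymm
    (LineMultiview.subset_lineMultiviewVariety hrank hcenters)
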